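/- Let $\lambda\in(0,\infty)$ and let $\psi$ be a non-negative integrable function on $(0,1)$ with $\lim_{x\uparrow1}\psi(x)=\psi_1\in(0,\infty)$ such that $x\mapsto\psi(x)(1-x)$ is a probability density on $(0,1)$ (the case $\beta=1$ of mixing densities $\psi(x)(1-x)^\beta$). Let $(\alpha^{(j)},(X^{(j)}_k)_{k\ge 0})$, $j=1,2,\dots$, be independent and identically distributed, where $\alpha^{(j)}$ has density $\psi(x)(1-x)$ on $(0,1)$ and, conditionally on $\alpha^{(j)}=a$, the process $(X^{(j)}_k)_{k\ge0}$ is a strictly stationary INAR(1) process with thinning parameter $a$ and Poisson innovations of parameter $\lambda$; that is, it has the law of the process given by $$X_k=\sum_{i=1}^{X_{k-1}}\xi_{k,i}+\varepsilon_k,\qquad k\ge1,$$ where $X_0$, $(\xi_{k,i})_{k,i\ge1}$, $(\varepsilon_k)_{k\ge1}$ are independent, $X_0$ is Poisson with parameter $\lambda/(1-a)$, the $\xi_{k,i}$ are Bernoulli with mean $a$ and the $\varepsilon_k$ are Poisson with parameter $\lambda$. For $N,n\ge1$ and $t\ge0$ put $$\widetilde S^{(N,n)}_t:=\sum_{j=1}^N\sum_{k=1}^{\lfloor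 nt\rfloor}\bigl(X^{(j)}_k-\mathbb E(X^{(j)}_k\mid\alpha^{(j)})\bigr).$$ Let $B=(B_t)_{t\ge0}$ be a standard Wiener process. Then, for every $N\ge2$, the finite-dimensional distributions of $\bigl((nN\log N)^{-1/2}\,\widetilde S^{(N,n)}_t\bigr)_{t\ge0}$ converge weakly as $n\to\infty$ to those of a process $Y^{(N)}=(Y^{(N)}_t)_{t\ge0}$, and the finite-dimensional distributions of $Y^{(N)}$ converge weakly as $N\to\infty$ to those of $\bigl(\sqrt{\lambda\psi_1}\,B_t\bigr)_{t\ge0}$. -/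

import Mathlib

open MeasureTheory ProbabilityTheory Filter Topology
open scoped NNReal ENNReal

noncomputable section

namespace RandomINAR

/-- The path of the recursion `x (k + 1) = ∑_{i < x k} ξ (k, i) + ε k` started at `x 0 = x₀`:
each of the `x k` individuals alive at time `k` survives (`ξ (k, i) = 1`) or dies
(`ξ (k, i) = 0`), and then `ε k` new individuals arrive. -/
def inarPath (x₀ : ℕ) (ξ : ℕ × ℕ → ℕ) (ε : ℕ → ℕ) : ℕ → ℕ
  | 0 => x₀
  | k + 1 => (∑ i ∈ Finset.range (inarPath x₀ ξ ε k), ξ (k, i)) + ε k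

/-- The joint law of the driving variables `(X₀, ξ, ε)` of the stationary INAR(1) process with
thinning parameter `a ∈ (0, 1)` and Poisson innovations of parameter `lam > 0`: all of them are
independent, `X₀` is Poisson with parameter `lam / (1 - a)`, the `ξ (k, i)` are Bernoulli with
mean `a` and the `ε k` are Poisson with parameter `lam`. -/
def inarDriving (lam a : ℝ) : Measure (ℕ × (ℕ × ℕ → ℕ) × (ℕ → ℕ)) :=
  (poissonMeasure (Real.toNNReal (lam / (1 - a)))).prod
    ((Measure.infinitePi fun _ : ℕ × ℕ =>
        bernoulliMeasure (1 : ℕ) 0 (Set.projIcc (0 : ℝ) 1 zero_le_one a)).prod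
      (Measure.infinitePi fun _ : ℕ => poissonMeasure (Real.toNNReal lam)))

/-- The law on `ℕ → ℕ` of the strictly stationary INAR(1) process with thinning parameter
`a ∈ (0, 1)` and Poisson innovations of parameter `lam > 0`. -/
def inarLaw (lam a : ℝ) : Measure (ℕ → ℕ) :=
  (inarDriving lam a).map fun w => inarPath w.1 w.2.1 w.2.2

/-- The path depends measurably on the driving variables, so that the push-forward in `inarLaw`
is a genuine one. -/
theorem measurable_inarPath :
    Measurable fun w : ℕ × (ℕ × ℕ → ℕ) × (ℕ → ℕ) => inarPath w.1 w.2.1 w.2.2 := by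
  refine measurable_pi_lambda _ fun k => ?_
  induction k with
  | zero => exact measurable_fst
  | succ k ih =>
    have h : Measurable fun p : ℕ × (ℕ × (ℕ × ℕ → ℕ) × (ℕ → ℕ)) =>
        (∑ i ∈ Finset.range p.1, p.2.2.1 (k, i)) + p.2.2.2 k := by
      refine measurable_from_prod_countable_right fun m => ?_
      refine Measurable.add ?_ (by fun_prop)
      have (i : ℕ) : Measurable fun y : ℕ × (ℕ × ℕ → ℕ) × (ℕ → ℕ) => y.2.1 (k, i) := by fun_prop
      exact Finset.measurable_fun_sum (Finset.range m) fun i _ => this i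
    exact h.comp (ih.prodMk measurable_id)

instance (lam a : ℝ) : IsProbabilityMeasure (inarLaw lam a) := by
  unfold inarLaw inarDriving
  exact Measure.isProbabilityMeasure_map measurable_inarPath.aemeasurable

variable {Ω : Type*} [MeasurableSpace Ω]

/-- `X` is a randomized INAR(1) process with random thinning parameter `α` and Poisson innovations
of parameter `lam`: conditionally on `α = a`, the process `(X k)` has the law of the strictly
stationary INAR(1) process with thinning parameter `a`. -/
structure IsRandomizedINAR (lam : ℝ) (α : Ω → ℝ) (X : ℕ → Ω → ℕ) (P : Measure Ω)
    [IsFiniteMeasure P] : Prop where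
  measurable_param : Measurable α
  measurable_process : ∀ k, Measurable (X k)
  param_mem : ∀ᵐ ω ∂P, α ω ∈ Set.Ioo (0 : ℝ) 1
  condLaw : ∀ᵐ a ∂(P.map α), condDistrib (fun ω k => X k ω) α P a = inarLaw lam a

/-- The aggregated centred partial sums
`∑_{j < N} ∑_{k = 1}^{⌊n t⌋} (X j k - E(X j k | α j))`. -/
def aggSum (P : Measure Ω) (α : ℕ → Ω → ℝ) (X : ℕ → ℕ → Ω → ℕ) (N n : ℕ) (t : ℝ≥0) (ω : Ω) : ℝ :=
  ∑ j ∈ Finset.range N, ∑ k ∈ Finset.Icc 1 ⌊(n : ℝ) * t⌋₊,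
    ((X j k ω : ℝ) -
      (P[fun ω' => (X j k ω' : ℝ) | MeasurableSpace.comap (α j) inferInstance]) ω)

/-- Weak convergence of all finite-dimensional distributions, along the filter `l`, of the real
processes `Y i` on `(Ω i, μ i)` to the process `Z` on `(Ω', μ')`, indexed by `[0, ∞)`. -/
def TendstoFDD {ι : Type*} {Ω : ι → Type*} {Ω' : Type*} [∀ i, MeasurableSpace (Ω i)]
    [MeasurableSpace Ω'] (Y : (i : ι) → ℝ≥0 → Ω i → ℝ) (l : Filter ι) (Z : ℝ≥0 → Ω' → ℝ)
    (μ : (i : ι) → Measure (Ω i)) [∀ i, IsProbabilityMeasure (μ i)]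
    (μ' : Measure Ω') [IsProbabilityMeasure μ'] : Prop :=
  ∀ I : Finset ℝ≥0,
    TendstoInDistribution (fun i ω (t : I) => Y i t ω) l (fun ω (t : I) => Z t ω) μ μ'

end RandomINAR

end

/-! Conditionally on the thinning parameter `a`, a stationary Poisson INAR(1) path is explicit
enough to compute with. Integrating the path out backwards in time, thinning replaces a weight `z`
by `1 - a + a * z` and the Poisson arrivals contribute an exponential, so the joint generating
function is a single exponential (`integral_inarLaw_prod_pow`). With weights `exp (i θ k)`, its
logarithm after centring is `-(lam / 2) * (1 + a) / (1 - a) ^ 2 * ∑ θ k ^ 2` up to an error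
controlled by the size and the total variation of `θ` (`norm_logChar_add_le`). A linear combination
of partial sums corresponds to a step function `θ` with boundedly many jumps, and this yields a
conditional Brownian limit with variance `lam * varShape a` (`tendsto_integral_exp_inarLaw`).

Dominated convergence in `a` and independence of the copies then identify the limit as `n → ∞`: a
Brownian motion multiplied by the independent amplitude `√(lam / (N log N) * ∑ varShape (α j))`.

For `N → ∞`, near `a = 1` the variance shape behaves like `2 / (1 - a) ^ 2` while the density
behaves like `ψ₁ * (1 - a)`, so `varShape (α j)` has tail about `ψ₁ / v`. Its mean is infinite, but
only logarithmically: the sum of `N` copies divided by `N log N` converges to the constant `ψ₁`. The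
proof works with Laplace transforms: `1 - E exp (-c * varShape α) ~ ψ₁ * c * log (1 / c)` as `c`
decreases to `0` (`tendsto_integral_one_sub_exp_div`), whose `N`-th power version is
`tendsto_integral_exp_neg_pow`. The random amplitude thus becomes the constant `√(lam * ψ₁)`. -/

namespace RandomINAR

/-! ### Product measures and elementary generating functions -/

/-- Two independent samples of a product measure can be spliced along any set of coordinates. -/
lemma measurePreserving_piecewise_infinitePi {ι : Type*} {X : ι → Type*}
    [∀ i, MeasurableSpace (X i)] (μ : ∀ i, Measure (X i)) [∀ i, IsProbabilityMeasure (μ i)]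
    (S : Set ι) [∀ i, Decidable (i ∈ S)] :
    MeasurePreserving (fun p : (∀ i, X i) × (∀ i, X i) => S.piecewise p.1 p.2)
      ((Measure.infinitePi μ).prod (Measure.infinitePi μ)) (Measure.infinitePi μ) := by
  have hm : Measurable (fun p : (∀ i, X i) × (∀ i, X i) => S.piecewise p.1 p.2) := by
    refine measurable_pi_lambda _ fun i => ?_
    by_cases hi : i ∈ S <;> simp only [Set.piecewise, hi, if_true, if_false] <;> fun_prop
  refine ⟨hm, Measure.eq_infinitePi _ fun s t ht => ?_⟩
  rw [Measure.map_apply hm (.pi s.countable_toSet fun i _ => ht i)]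
  have : (fun p : (∀ i, X i) × (∀ i, X i) => S.piecewise p.1 p.2) ⁻¹' (Set.pi s t) =
      (Set.pi (s.filter (· ∈ S)) t) ×ˢ (Set.pi (s.filter (· ∉ S)) t) := by
    ext p
    simp only [Set.mem_preimage, Set.mem_pi, Set.mem_prod, Finset.coe_filter, Set.mem_ofPred_eq]
    constructor
    · intro h
      refine ⟨fun i hi => ?_, fun i hi => ?_⟩
      · simpa [Set.piecewise, hi.2] using h i hi.1
      · simpa [Set.piecewise, hi.2] using h i hi.1
    · rintro ⟨h1, h2⟩ i hi
      by_cases hS : i ∈ S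
      · simpa [Set.piecewise, hS] using h1 i ⟨hi, hS⟩
      · simpa [Set.piecewise, hS] using h2 i ⟨hi, hS⟩
  rw [this, Measure.prod_prod, Measure.infinitePi_pi _ (fun i _ => ht i),
    Measure.infinitePi_pi _ (fun i _ => ht i), Finset.prod_filter_mul_prod_filter_not]

/-- The exchange of the two middle factors preserves a fourfold product measure. -/
lemma measurePreserving_prodProdProdComm {A B C D : Type*} [MeasurableSpace A]
    [MeasurableSpace B] [MeasurableSpace C] [MeasurableSpace D] (μa : Measure A) (μb : Measure B)
    (μc : Measure C) (μd : Measure D) [SFinite μa] [SFinite μb] [SFinite μc] [SFinite μd] :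
    MeasurePreserving (fun p : (A × B) × C × D => ((p.1.1, p.2.1), p.1.2, p.2.2))
      ((μa.prod μb).prod (μc.prod μd)) ((μa.prod μc).prod (μb.prod μd)) := by
  have hm : Measurable (fun p : (A × B) × C × D => ((p.1.1, p.2.1), p.1.2, p.2.2)) := by fun_prop
  refine ⟨hm, Measure.ext_of_lintegral _ fun f hf => ?_⟩
  rw [lintegral_map hf hm, lintegral_prod _ (by fun_prop), lintegral_prod _ (by fun_prop),
    lintegral_prod _ (by fun_prop), lintegral_prod _ (by fun_prop)]
  refine lintegral_congr fun a => ?_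
  have h1 (b : B) : ∫⁻ y : C × D, f ((a, y.1), b, y.2) ∂(μc.prod μd) =
      ∫⁻ c, ∫⁻ d, f ((a, c), b, d) ∂μd ∂μc := lintegral_prod _ (by fun_prop)
  have h2 (c : C) : ∫⁻ y : B × D, f ((a, c), y) ∂(μb.prod μd) =
      ∫⁻ b, ∫⁻ d, f ((a, c), b, d) ∂μd ∂μb := lintegral_prod _ (by fun_prop)
  simp only [h1, h2]
  exact lintegral_lintegral_swap (by fun_prop)

lemma integral_pow_poissonMeasure (r : ℝ≥0) (z : ℂ) :
    ∫ n, z ^ n ∂(poissonMeasure r) = Complex.exp (r * (z - 1)) := by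
  rw [integral_poissonMeasure]
  have h (n : ℕ) : (Real.exp (-r) * r ^ n / n.factorial) • z ^ n =
      Complex.exp (-r) * ((r * z) ^ n / n.factorial) := by
    rw [Complex.real_smul]; push_cast; ring
  simp_rw [h]
  rw [tsum_mul_left, (NormedSpace.expSeries_div_hasSum_exp (r * z)).tsum_eq,
    ← Complex.exp_eq_exp_ℂ, ← Complex.exp_add]
  ring_nf

lemma integral_pow_bernoulliMeasure {a : ℝ} (ha : a ∈ Set.Ioo (0 : ℝ) 1) (z : ℂ) :
    ∫ n, z ^ n ∂(bernoulliMeasure (1 : ℕ) 0 (Set.projIcc (0 : ℝ) 1 zero_le_one a)) =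
      1 - a + a * z := by
  rw [integral_bernoulliMeasure, Set.projIcc_of_mem _ (Set.Ioo_subset_Icc_self ha)]
  simp only [pow_one, pow_zero, Complex.real_smul]
  push_cast; ring

/-- Integral over a product measure of a finite product of functions of distinct coordinates. -/
lemma integral_infinitePi_prod {ι κ X : Type*} [Fintype κ] [MeasurableSpace X]
    (μ : Measure X) [IsProbabilityMeasure μ] (e : κ → ι) (he : Function.Injective e)
    (f : X → ℂ) (hf : Measurable f) :
    ∫ x, ∏ k, f (x (e k)) ∂(Measure.infinitePi fun _ : ι => μ) =
      ∏ _k : κ, ∫ y, f y ∂μ := by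
  have h0 : iIndepFun (fun (i : ι) (x : ι → X) => x i) (Measure.infinitePi fun _ : ι => μ) :=
    iIndepFun_infinitePi (X := fun _ x => x) (fun _ => measurable_id)
  have h1 := h0.precomp he
  have h2 := h1.integral_fun_prod_comp (f := fun _ => f)
    (fun i => (measurable_pi_apply _).aemeasurable) (fun i => hf.aestronglyMeasurable)
  rw [h2]
  refine Finset.prod_congr rfl fun k _ => ?_
  have := (measurePreserving_eval_infinitePi (fun _ : ι => μ) (e k))
  conv_rhs => rw [← this.map_eq, integral_map this.aemeasurable hf.aestronglyMeasurable]

/-! ### Joint generating function of the stationary path -/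

lemma inarPath_congr (x₀ : ℕ) {ξ ξ' : ℕ × ℕ → ℕ} {ε ε' : ℕ → ℕ} (m : ℕ)
    (hξ : ∀ k < m, ∀ i, ξ (k, i) = ξ' (k, i)) (hε : ∀ k < m, ε k = ε' k) :
    ∀ k ≤ m, inarPath x₀ ξ ε k = inarPath x₀ ξ' ε' k := by
  intro k hk
  induction k with
  | zero => rfl
  | succ k ih =>
    simp only [inarPath]
    rw [ih (by omega), hε k (by omega)]
    congr 1
    exact Finset.sum_congr rfl fun i _ => hξ k (by omega) i


/-- One step of the joint generating function of the stationary INAR(1) path: integrating out the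
driving variables of time `m` turns the weight `z` at time `m + 1` into
`1 - a + a * z` at time `m`. -/
lemma integral_inarDriving_step (lam a : ℝ) (ha : a ∈ Set.Ioo (0 : ℝ) 1) (w : ℕ → ℂ)
    (hw : ∀ k, ‖w k‖ ≤ 1) (m : ℕ) (z : ℂ) (hz : ‖z‖ ≤ 1) :
    ∫ p, (∏ k ∈ Finset.Icc 1 m, w k ^ inarPath p.1 p.2.1 p.2.2 k) *
        z ^ inarPath p.1 p.2.1 p.2.2 (m + 1) ∂(inarDriving lam a) =
      Complex.exp (Real.toNNReal lam * (z - 1)) *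
      ∫ p, (∏ k ∈ Finset.Icc 1 m, w k ^ inarPath p.1 p.2.1 p.2.2 k) *
        (1 - a + a * z) ^ inarPath p.1 p.2.1 p.2.2 m ∂(inarDriving lam a) := by
  classical
  set μξ := Measure.infinitePi fun _ : ℕ × ℕ =>
        bernoulliMeasure (1 : ℕ) 0 (Set.projIcc (0 : ℝ) 1 zero_le_one a) with hμξ
  set με := Measure.infinitePi fun _ : ℕ => poissonMeasure (Real.toNNReal lam) with hμε
  set μ0 := poissonMeasure (Real.toNNReal (lam / (1 - a))) with hμ0
  have hD : inarDriving lam a = μ0.prod (μξ.prod με) := rfl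
  -- The path up to time `m` reads only driving variables with time index `< m`; the step to `m + 1`
  -- reads those with index `m`. Replacing every variable of index `≥ m` by an independent copy
  -- preserves the law and makes the next step independent of the past, so Fubini applies.
  let S : Set (ℕ × ℕ) := {p | p.1 < m}
  let T : Set ℕ := {k | k < m}
  have hS := measurePreserving_piecewise_infinitePi (fun _ : ℕ × ℕ =>
        bernoulliMeasure (1 : ℕ) 0 (Set.projIcc (0 : ℝ) 1 zero_le_one a)) S
  have hT := measurePreserving_piecewise_infinitePi
    (fun _ : ℕ => poissonMeasure (Real.toNNReal lam)) T
  rw [← hμξ] at hS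
  rw [← hμε] at hT
  -- splicing both driving sequences at time `m`
  let Ψ : (ℕ × (ℕ × ℕ → ℕ) × (ℕ → ℕ)) × ((ℕ × ℕ → ℕ) × (ℕ → ℕ)) →
      ℕ × (ℕ × ℕ → ℕ) × (ℕ → ℕ) :=
    fun q => (q.1.1, S.piecewise q.1.2.1 q.2.1, T.piecewise q.1.2.2 q.2.2)
  have hΨ : MeasurePreserving Ψ ((inarDriving lam a).prod (μξ.prod με)) (inarDriving lam a) := by
    have h1 := (hS.prod hT).comp (measurePreserving_prodProdProdComm μξ με μξ με)
    exact ((MeasurePreserving.id μ0).prod h1).comp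
      (measurePreserving_prodAssoc μ0 (μξ.prod με) (μξ.prod με))
  have hcur (q) (k) (hk : k ≤ m) : inarPath (Ψ q).1 (Ψ q).2.1 (Ψ q).2.2 k =
      inarPath q.1.1 q.1.2.1 q.1.2.2 k :=
    inarPath_congr _ m (fun k hk i => by simp [Ψ, S, Set.piecewise, hk])
      (fun k hk => by simp [Ψ, T, Set.piecewise, hk]) k hk
  have hnext (q) : inarPath (Ψ q).1 (Ψ q).2.1 (Ψ q).2.2 (m + 1) =
      (∑ i ∈ Finset.range (inarPath q.1.1 q.1.2.1 q.1.2.2 m), q.2.1 (m, i)) + q.2.2 m := by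
    rw [inarPath, hcur q m le_rfl]
    simp [Ψ, S, T, Set.piecewise]
  have hX (k : ℕ) : Measurable fun p : ℕ × (ℕ × ℕ → ℕ) × (ℕ → ℕ) => inarPath p.1 p.2.1 p.2.2 k :=
    (measurable_pi_apply k).comp measurable_inarPath
  have hpow (c : ℂ) (k : ℕ) : Measurable fun p : ℕ × (ℕ × ℕ → ℕ) × (ℕ → ℕ) =>
      c ^ inarPath p.1 p.2.1 p.2.2 k := (Measurable.of_discrete (f := fun j : ℕ => c ^ j)).comp (hX k)
  have hK : Measurable fun p : ℕ × (ℕ × ℕ → ℕ) × (ℕ → ℕ) =>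
      ∏ k ∈ Finset.Icc 1 m, w k ^ inarPath p.1 p.2.1 p.2.2 k :=
    Finset.measurable_fun_prod _ fun k _ => hpow (w k) k
  have hF : Measurable fun p : ℕ × (ℕ × ℕ → ℕ) × (ℕ → ℕ) =>
      (∏ k ∈ Finset.Icc 1 m, w k ^ inarPath p.1 p.2.1 p.2.2 k) *
        z ^ inarPath p.1 p.2.1 p.2.2 (m + 1) := hK.mul (hpow z _)
  have : IsProbabilityMeasure (inarDriving lam a) := by rw [hD]; infer_instance
  have hbd (p : ℕ × (ℕ × ℕ → ℕ) × (ℕ → ℕ)) :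
      ‖(∏ k ∈ Finset.Icc 1 m, w k ^ inarPath p.1 p.2.1 p.2.2 k) *
        z ^ inarPath p.1 p.2.1 p.2.2 (m + 1)‖ ≤ 1 := by
    rw [norm_mul, norm_prod, norm_pow]
    refine mul_le_one₀ (Finset.prod_le_one (fun _ _ => norm_nonneg _) fun k _ => ?_)
      (by positivity) (pow_le_one₀ (norm_nonneg _) hz)
    rw [norm_pow]
    exact pow_le_one₀ (norm_nonneg _) (hw k)
  rw [← hΨ.map_eq, integral_map hΨ.measurable.aemeasurable hF.aestronglyMeasurable, hΨ.map_eq,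
    integral_prod (fun q => (∏ k ∈ Finset.Icc 1 m, w k ^ inarPath (Ψ q).1 (Ψ q).2.1 (Ψ q).2.2 k) *
        z ^ inarPath (Ψ q).1 (Ψ q).2.1 (Ψ q).2.2 (m + 1))
      (Integrable.of_bound (hF.comp hΨ.measurable).aestronglyMeasurable 1
      (Eventually.of_forall fun q => hbd (Ψ q))), ← integral_const_mul]
  refine integral_congr_ae (Eventually.of_forall fun p => ?_)
  simp only [hnext]
  have h1 (y) : ∏ k ∈ Finset.Icc 1 m, w k ^ inarPath (Ψ (p, y)).1 (Ψ (p, y)).2.1 (Ψ (p, y)).2.2 k =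
      ∏ k ∈ Finset.Icc 1 m, w k ^ inarPath p.1 p.2.1 p.2.2 k :=
    Finset.prod_congr rfl fun k hk => by rw [hcur (p, y) k (Finset.mem_Icc.1 hk).2]
  simp only [h1, integral_const_mul]
  -- With the past frozen, the number of survivors is a sum over a fixed range, and the power of `z`
  -- factors into survivors and arrivals.
  simp only [pow_add, ← Finset.prod_pow_eq_pow_sum]
  rw [integral_prod_mul (fun x : ℕ × ℕ → ℕ => ∏ i ∈ Finset.range (inarPath p.1 p.2.1 p.2.2 m),
    z ^ x (m, i)) (fun y : ℕ → ℕ => z ^ y m)]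
  have h2 : ∫ y, z ^ y m ∂με = Complex.exp (Real.toNNReal lam * (z - 1)) := by
    have := measurePreserving_eval_infinitePi (fun _ : ℕ => poissonMeasure (Real.toNNReal lam)) m
    rw [← integral_pow_poissonMeasure, ← this.map_eq,
      integral_map this.aemeasurable Measurable.of_discrete.aestronglyMeasurable]
  have h3 (n : ℕ) : ∫ x, ∏ i ∈ Finset.range n, z ^ x (m, i) ∂μξ = (1 - a + a * z) ^ n := by
    have := integral_infinitePi_prod
      (bernoulliMeasure (1 : ℕ) 0 (Set.projIcc (0 : ℝ) 1 zero_le_one a)) (fun i : Fin n => (m, (i : ℕ)))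
      (fun i j hij => Fin.ext (by simpa using hij)) (fun n => z ^ n) Measurable.of_discrete
    simp only [integral_pow_bernoulliMeasure ha, Finset.prod_const, Finset.card_univ,
      Fintype.card_fin] at this
    rw [← this]
    simp_rw [Finset.prod_range]
    rfl
  rw [h2, h3]
  ring

lemma norm_thinning_le_one {a : ℝ} (ha : a ∈ Set.Ioo (0 : ℝ) 1) {z : ℂ} (hz : ‖z‖ ≤ 1) :
    ‖1 - (a : ℂ) + a * z‖ ≤ 1 := by
  have h1 : ‖(1 - a : ℂ)‖ = 1 - a := by
    rw [← Complex.ofReal_one, ← Complex.ofReal_sub, Complex.norm_real, Real.norm_eq_abs,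
      abs_of_pos (by linarith [ha.2])]
  calc ‖1 - (a : ℂ) + a * z‖ ≤ ‖(1 - a : ℂ)‖ + ‖(a : ℂ) * z‖ := norm_add_le _ _
    _ = (1 - a) + a * ‖z‖ := by
        rw [h1, norm_mul, Complex.norm_real, Real.norm_eq_abs, abs_of_pos ha.1]
    _ ≤ 1 := by nlinarith [ha.1]

/-- The joint generating function of a stationary INAR(1) path. The weights `w` are absorbed from
the last time backwards through the recursion `Z k = 1 - a + a * (w (k + 1) * Z (k + 1))`. -/
theorem integral_inarLaw_prod_pow {lam a : ℝ} (hlam : 0 < lam) (ha : a ∈ Set.Ioo (0 : ℝ) 1)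
    {w : ℕ → ℂ} (hw : ∀ k, ‖w k‖ ≤ 1) {Z : ℕ → ℂ} (m : ℕ) (hZm : ‖Z m‖ ≤ 1)
    (hZ : ∀ k < m, Z k = 1 - a + a * (w (k + 1) * Z (k + 1))) :
    ∫ x, (∏ k ∈ Finset.Icc 1 m, w k ^ x k) * Z m ^ x m ∂(inarLaw lam a) =
      Complex.exp (lam / (1 - a) * (Z m - 1 + ∑ k ∈ Finset.Icc 1 m, (w k - 1) * Z k)) := by
  have h1a : (0 : ℝ) < 1 - a := by linarith [ha.2]
  have hmeas (m : ℕ) (z : ℂ) : Measurable fun x : ℕ → ℕ =>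
      (∏ k ∈ Finset.Icc 1 m, w k ^ x k) * z ^ x m := by
    have (c : ℂ) (k : ℕ) : Measurable fun x : ℕ → ℕ => c ^ x k :=
      (Measurable.of_discrete (f := fun j : ℕ => c ^ j)).comp (measurable_pi_apply k)
    exact (Finset.measurable_fun_prod _ fun k _ => this (w k) k).mul (this z m)
  rw [inarLaw, integral_map measurable_inarPath.aemeasurable (hmeas m _).aestronglyMeasurable]
  induction m with
  | zero =>
    have h := integral_pow_poissonMeasure (Real.toNNReal (lam / (1 - a))) (Z 0)
    rw [Real.coe_toNNReal _ (by positivity)] at h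
    simp only [inarDriving, inarPath, Finset.Icc_eq_empty_of_lt Nat.zero_lt_one,
      Finset.prod_empty, Finset.sum_empty, one_mul, add_zero]
    rw [integral_fun_fst (fun n : ℕ => Z 0 ^ n), h]
    simp
  | succ m ih =>
    have hwz : ‖w (m + 1) * Z (m + 1)‖ ≤ 1 := by
      rw [norm_mul]; exact mul_le_one₀ (hw _) (norm_nonneg _) hZm
    have hm := hZ m (by omega)
    have hstep := integral_inarDriving_step lam a ha w hw m _ hwz
    rw [← hm] at hstep
    simp only [Finset.prod_Icc_succ_top (Nat.le_add_left 1 m), mul_assoc, ← mul_pow]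
    rw [hstep, ih (hm ▸ norm_thinning_le_one ha hwz) (fun k hk => hZ k (by omega)),
      ← Complex.exp_add, Real.coe_toNNReal _ hlam.le,
      Finset.sum_Icc_succ_top (Nat.le_add_left 1 m), hm]
    congr 1
    -- The exponents match because `Z m - 1 = a * (w Z - 1)`, with `w Z` taken at `m + 1`: the
    -- exponent grows by `lam / (1 - a) * ((w Z - 1) - a * (w Z - 1))`, which is the arrival term
    -- `lam * (w Z - 1)`.
    have : (1 - a : ℂ) ≠ 0 := by exact_mod_cast h1a.ne'
    field_simp
    ring

/-- Stationarity, read off the joint generating function: with all weights `1` and terminal value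
`z` the recursion is solved by `1 + a ^ (m - k) * (z - 1)`, and only the Poisson exponent `lam / (1
- a) * (z - 1)` remains. -/
lemma map_eval_inarLaw {lam a : ℝ} (hlam : 0 < lam) (ha : a ∈ Set.Ioo (0 : ℝ) 1) (m : ℕ) :
    (inarLaw lam a).map (fun x => x m) = poissonMeasure (Real.toNNReal (lam / (1 - a))) := by
  have h1a : (0 : ℝ) < 1 - a := by linarith [ha.2]
  refine (MeasurableEmbedding.natCast (α := ℝ)).map_injective ?_
  have hm : AEMeasurable (fun x : ℕ → ℕ => x m) (inarLaw lam a) :=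
    (measurable_pi_apply m).aemeasurable
  have : IsProbabilityMeasure ((inarLaw lam a).map (fun x => x m)) :=
    Measure.isProbabilityMeasure_map hm
  have : IsProbabilityMeasure (((inarLaw lam a).map (fun x => x m)).map (Nat.cast : ℕ → ℝ)) :=
    Measure.isProbabilityMeasure_map (by fun_prop)
  have : IsProbabilityMeasure
      ((poissonMeasure (Real.toNNReal (lam / (1 - a)))).map (Nat.cast : ℕ → ℝ)) :=
    Measure.isProbabilityMeasure_map (by fun_prop)
  refine Measure.ext_of_charFun (funext fun t => ?_)
  rw [charFun_map_cast_poissonMeasure, charFun_apply_real,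
    integral_map (by fun_prop) (by fun_prop), integral_map hm (by fun_prop)]
  set z := Complex.exp (t * Complex.I) with hz
  have hz1 : ‖z‖ = 1 := Complex.norm_exp_ofReal_mul_I t
  have h := integral_inarLaw_prod_pow hlam ha (w := fun _ => 1) (fun _ => by simp)
    (Z := fun k => 1 + a ^ (m - k) * (z - 1)) m (by simp [hz1]) (fun k hk => by
      have : m - k = m - (k + 1) + 1 := by omega
      rw [this, pow_succ]; ring)
  simp only [one_pow, Finset.prod_const_one, one_mul, sub_self, zero_mul, Finset.sum_const_zero,
    add_zero, tsub_self, pow_zero, add_sub_cancel] at h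
  rw [Real.coe_toNNReal _ (by positivity)]
  push_cast
  rw [← h]
  refine integral_congr_ae (Eventually.of_forall fun x => ?_)
  simp only [hz, ← Complex.exp_nat_mul]
  ring_nf

lemma integrable_cast_poissonMeasure (r : ℝ≥0) :
    Integrable (fun n : ℕ => (n : ℝ)) (poissonMeasure r) ∧
      ∫ n, (n : ℝ) ∂(poissonMeasure r) = r := by
  have h0 := (NormedSpace.expSeries_div_hasSum_exp (r : ℝ)).mul_left (Real.exp (-r) * r)
  have h1 : HasSum (fun n : ℕ => Real.exp (-r) * r ^ n / n.factorial * (n : ℝ)) r := by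
    rw [← hasSum_nat_add_iff' 1]
    simp only [Finset.range_one, Finset.sum_singleton, Nat.cast_zero, mul_zero, sub_zero]
    have h2 : (fun n : ℕ => Real.exp (-r) * r ^ (n + 1) / (n + 1).factorial * ((n + 1 : ℕ) : ℝ)) =
        fun n => Real.exp (-r) * r * (r ^ n / n.factorial) := by
      funext n
      rw [Nat.factorial_succ, pow_succ]
      push_cast
      have : (n.factorial : ℝ) ≠ 0 := by positivity
      field_simp
    rw [← Real.exp_eq_exp_ℝ, mul_right_comm, ← Real.exp_add, neg_add_cancel, Real.exp_zero,
      one_mul] at h0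
    rw [h2]
    exact h0
  have h2 : Integrable (fun n : ℕ => (n : ℝ)) (poissonMeasure r) := by
    rw [integrable_poissonMeasure_iff]
    simpa using h1.summable
  exact ⟨h2, (hasSum_integral_poissonMeasure h2).unique (by simpa using h1)⟩

lemma integrable_eval_inarLaw {lam a : ℝ} (hlam : 0 < lam) (ha : a ∈ Set.Ioo (0 : ℝ) 1) (m : ℕ) :
    Integrable (fun x : ℕ → ℕ => (x m : ℝ)) (inarLaw lam a) ∧
      ∫ x, (x m : ℝ) ∂(inarLaw lam a) = lam / (1 - a) := by
  have h1a : (0 : ℝ) < 1 - a := by linarith [ha.2]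
  have h := integrable_cast_poissonMeasure (Real.toNNReal (lam / (1 - a)))
  have hm : AEMeasurable (fun x : ℕ → ℕ => x m) (inarLaw lam a) :=
    (measurable_pi_apply m).aemeasurable
  rw [← map_eval_inarLaw hlam ha m, Real.coe_toNNReal _ (by positivity),
    integral_map hm (by fun_prop), integrable_map_measure (by fun_prop) hm] at h
  exact h

/-! ### Second order expansion of the log-characteristic function -/

lemma norm_exp_ofReal_mul_I_sub_taylor_le {x : ℝ} (hx : |x| ≤ 1) :
    ‖Complex.exp (x * Complex.I) - 1‖ ≤ |x| ∧
    ‖Complex.exp (x * Complex.I) - 1 - x * Complex.I‖ ≤ |x| ^ 2 ∧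
    ‖Complex.exp (x * Complex.I) - 1 - x * Complex.I + (x : ℂ) ^ 2 / 2‖ ≤ |x| ^ 3 := by
  have hn : ‖(x * Complex.I : ℂ)‖ = |x| := by simp
  refine ⟨?_, ?_, ?_⟩
  · rw [mul_comm]; exact Real.norm_exp_I_mul_ofReal_sub_one_le
  · simpa [hn] using Complex.norm_exp_sub_one_sub_id_le (x := x * Complex.I) (by rw [hn]; exact hx)
  · have h := Complex.exp_bound (x := x * Complex.I) (by rw [hn]; exact hx) (n := 3) (by norm_num)
    rw [hn] at h
    have h2 : Complex.exp (x * Complex.I) - 1 - x * Complex.I + (x : ℂ) ^ 2 / 2 =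
        Complex.exp (x * Complex.I) -
          ∑ m ∈ Finset.range 3, (x * Complex.I : ℂ) ^ m / (m.factorial : ℂ) := by
      simp only [Finset.sum_range_succ, Finset.sum_range_zero, Nat.factorial]
      push_cast
      ring_nf
      rw [Complex.I_sq]
      ring
    rw [h2]
    refine h.trans ?_
    have : ((Nat.succ 3 : ℕ) : ℝ) * (((Nat.factorial 3 : ℕ) : ℝ) * (3 : ℕ))⁻¹ ≤ 1 := by
      norm_num [Nat.factorial]
    exact mul_le_of_le_one_right (by positivity) this

/-- The solution of the backward recursion `Z k = 1 - a + a * (w (k + 1) * Z (k + 1))` with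
`Z k = 1` for `m ≤ k`, listed backwards from time `m`. -/
noncomputable def backwardArg (a : ℝ) (w : ℕ → ℂ) (m : ℕ) : ℕ → ℂ
  | 0 => 1
  | j + 1 => 1 - a + a * (w (m - j) * backwardArg a w m j)

section Recursion

variable {a : ℝ} {w Z : ℕ → ℂ} {m : ℕ}

/-- Since the weights are `1` beyond `m`, the constant `1` solves the recursion there, so the
solution can be taken on all of `ℕ` without a boundary case. -/
lemma exists_backward_solution (ha : a ∈ Set.Ioo (0 : ℝ) 1) (hw : ∀ k, ‖w k‖ ≤ 1)
    (hwm : ∀ k, m < k → w k = 1) :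
    ∃ Z : ℕ → ℂ, (∀ k, Z k = 1 - a + a * (w (k + 1) * Z (k + 1))) ∧ (∀ k, m ≤ k → Z k = 1) ∧
      ∀ k, ‖Z k‖ ≤ 1 := by
  refine ⟨fun k => backwardArg a w m (m - k), fun k => ?_, fun k hk => ?_, fun k => ?_⟩
  · rcases lt_or_ge k m with hk | hk
    · obtain ⟨j, hj⟩ : ∃ j, m - k = j + 1 := ⟨m - k - 1, by omega⟩
      have h1 : m - (k + 1) = j := by omega
      have h2 : m - j = k + 1 := by omega
      simp only [hj, h1, backwardArg, h2]
    · have h1 : m - k = 0 := by omega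
      have h2 : m - (k + 1) = 0 := by omega
      simp [h1, h2, backwardArg, hwm (k + 1) (by omega)]
  · simp [Nat.sub_eq_zero_of_le hk, backwardArg]
  · show ‖backwardArg a w m (m - k)‖ ≤ 1
    generalize m - k = j
    induction j with
    | zero => simp [backwardArg]
    | succ j ih =>
      refine norm_thinning_le_one ha ?_
      rw [norm_mul]
      exact mul_le_one₀ (hw _) (norm_nonneg _) ih

variable {θ : ℕ → ℝ} {Θ V : ℝ}

/-- From `Z k - 1 = a * ((w - 1) + w * (Z (k + 1) - 1))` with `‖w‖ = 1`, the deviation from `1` is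
contracted by `a` at each step and fed by at most `a * Θ`. The bound propagates because `a * (2 - a)
≤ 1`, and it does not depend on `m`. -/
lemma norm_backward_sub_one_le (ha : a ∈ Set.Ioo (0 : ℝ) 1) (hΘ1 : Θ ≤ 1) (hθ : ∀ k, |θ k| ≤ Θ)
    (hZ : ∀ k, Z k = 1 - a + a * (Complex.exp (θ (k + 1) * Complex.I) * Z (k + 1)))
    (hZm : ∀ k, m ≤ k → Z k = 1) (k : ℕ) : ‖Z k - 1‖ ≤ Θ / (1 - a) := by
  have h1a : (0 : ℝ) < 1 - a := by linarith [ha.2]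
  have hΘ0 : 0 ≤ Θ := (abs_nonneg _).trans (hθ 0)
  obtain ⟨j, hj⟩ : ∃ j, m ≤ k + j := ⟨m, by omega⟩
  induction j generalizing k with
  | zero => rw [hZm k hj, sub_self, norm_zero]; positivity
  | succ j ih =>
    have h := ih (k + 1) (by omega)
    set w := Complex.exp (θ (k + 1) * Complex.I) with hw
    have hw1 : ‖w‖ = 1 := Complex.norm_exp_ofReal_mul_I _
    have hw2 : ‖w - 1‖ ≤ Θ :=
      (norm_exp_ofReal_mul_I_sub_taylor_le ((hθ _).trans hΘ1)).1.trans (hθ _)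
    have : Z k - 1 = a * ((w - 1) + w * (Z (k + 1) - 1)) := by rw [hZ k]; ring
    rw [this, norm_mul, Complex.norm_real, Real.norm_eq_abs, abs_of_pos ha.1]
    calc a * ‖(w - 1) + w * (Z (k + 1) - 1)‖ ≤ a * (Θ + Θ / (1 - a)) := by
          refine mul_le_mul_of_nonneg_left ((norm_add_le _ _).trans (add_le_add hw2 ?_)) ha.1.le
          rwa [norm_mul, hw1, one_mul]
      _ ≤ Θ / (1 - a) := by
          rw [le_div_iff₀ h1a]
          field_simp
          nlinarith [sq_nonneg (1 - a), ha.1]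

/-- Second order expansion of the logarithm of the characteristic function of a stationary INAR(1)
path, for weights of small total variation. -/
lemma norm_logChar_add_le (ha : a ∈ Set.Ioo (0 : ℝ) 1) (hΘ1 : Θ ≤ 1) (hθ : ∀ k, |θ k| ≤ Θ)
    (hθm : ∀ k, m < k → θ k = 0) (hV : ∑ k ∈ Finset.Icc 1 m, |θ (k + 1) - θ k| ≤ V)
    (hZ : ∀ k, Z k = 1 - a + a * (Complex.exp (θ (k + 1) * Complex.I) * Z (k + 1)))
    (hZm : ∀ k, m ≤ k → Z k = 1) :
    ‖∑ k ∈ Finset.Icc 1 m, (Complex.exp (θ k * Complex.I) - 1 - θ k * Complex.I +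
        (Complex.exp (θ k * Complex.I) - 1) * (Z k - 1)) +
      (((1 + a) / (2 * (1 - a)) * ∑ k ∈ Finset.Icc 1 m, θ k ^ 2 : ℝ) : ℂ)‖ ≤
      m * Θ ^ 3 * (1 + 1 / (1 - a)) ^ 2 + Θ * V / (1 - a) ^ 2 := by
  have h1a : (0 : ℝ) < 1 - a := by linarith [ha.2]
  have h1ac : (1 - a : ℂ) ≠ 0 := by exact_mod_cast h1a.ne'
  have hΘ0 : 0 ≤ Θ := (abs_nonneg _).trans (hθ 0)
  have hη := norm_backward_sub_one_le ha hΘ1 hθ hZ hZm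
  have hT (k : ℕ) := norm_exp_ofReal_mul_I_sub_taylor_le ((hθ k).trans hΘ1)
  have hp2 (k : ℕ) : |θ k| ^ 2 ≤ Θ ^ 2 := pow_le_pow_left₀ (abs_nonneg _) (hθ k) 2
  have hp3 (k : ℕ) : |θ k| ^ 3 ≤ Θ ^ 3 := pow_le_pow_left₀ (abs_nonneg _) (hθ k) 3
  -- For constant `θ` the linearised recursion `ζ = a * (i θ + ζ)` has fixed point `i θ a / (1 -
  -- a)`. The deviation `d` of `Z - 1` from this value is driven only by the increments of `θ` and
  -- by second order terms.
  set d : ℕ → ℂ := fun k => (Z k - 1) - θ k * Complex.I * (a / (1 - a)) with hd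
  have hstep (k : ℕ) : ‖d k‖ ≤ a * ‖d (k + 1)‖ + |θ (k + 1) - θ k| / (1 - a) +
      Θ ^ 2 * (1 + 1 / (1 - a)) := by
    set w := Complex.exp (θ (k + 1) * Complex.I) with hw
    have e : d k = a * d (k + 1) + ((θ (k + 1) - θ k : ℝ) : ℂ) * (Complex.I * (a / (1 - a))) +
        a * ((w - 1 - θ (k + 1) * Complex.I) + (w - 1) * (Z (k + 1) - 1)) := by
      simp only [hd]
      rw [hZ k, ← hw]
      push_cast
      field_simp
      ring
    have n1 : ‖(a : ℂ) * d (k + 1)‖ = a * ‖d (k + 1)‖ := by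
      rw [norm_mul, Complex.norm_real, Real.norm_eq_abs, abs_of_pos ha.1]
    have n2 : ‖((θ (k + 1) - θ k : ℝ) : ℂ) * (Complex.I * (a / (1 - a)))‖ ≤
        |θ (k + 1) - θ k| / (1 - a) := by
      have : (a / (1 - a) : ℂ) = ((a / (1 - a) : ℝ) : ℂ) := by push_cast; rfl
      rw [this, norm_mul, norm_mul, Complex.norm_I, one_mul, Complex.norm_real, Complex.norm_real,
        Real.norm_eq_abs, Real.norm_eq_abs, abs_of_pos (div_pos ha.1 h1a), div_eq_mul_inv _ (1 - a)]
      refine mul_le_mul_of_nonneg_left ?_ (abs_nonneg _)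
      exact mul_le_of_le_one_left (by positivity) ha.2.le
    have n3 : ‖(a : ℂ) * ((w - 1 - θ (k + 1) * Complex.I) + (w - 1) * (Z (k + 1) - 1))‖ ≤
        Θ ^ 2 * (1 + 1 / (1 - a)) := by
      rw [norm_mul, Complex.norm_real, Real.norm_eq_abs, abs_of_pos ha.1]
      refine (mul_le_of_le_one_left (norm_nonneg _) ha.2.le).trans ((norm_add_le _ _).trans ?_)
      rw [norm_mul]
      have := mul_le_mul ((hT (k + 1)).1.trans (hθ _)) (hη (k + 1)) (norm_nonneg _) hΘ0
      calc _ ≤ Θ ^ 2 + Θ * (Θ / (1 - a)) := add_le_add ((hT (k + 1)).2.1.trans (hp2 _)) this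
        _ = _ := by ring
    rw [e]
    exact (norm_add₃_le).trans (add_le_add (add_le_add n1.le n2) n3)
  have hdm (k : ℕ) (hk : m < k) : d k = 0 := by simp [hd, hZm k hk.le, hθm k hk]
  -- Summing `hstep` and using that `d` vanishes at `m + 1`, the shifted sum is absorbed on the left
  -- with factor `1 - a`. Total variation enters here.
  have hD : ∑ k ∈ Finset.Icc 1 m, ‖d k‖ ≤ (V / (1 - a) + m * (Θ ^ 2 * (1 + 1 / (1 - a)))) / (1 - a) := by
    have hshift : ∑ k ∈ Finset.Icc 1 m, ‖d (k + 1)‖ ≤ ∑ k ∈ Finset.Icc 1 m, ‖d k‖ := by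
      have h1 : ∑ k ∈ Finset.range m, ‖d (k + 1 + 1)‖ ≤ ∑ k ∈ Finset.range m, ‖d (k + 1)‖ := by
        have e1 := Finset.sum_range_succ (fun k => ‖d (k + 1)‖) m
        have e2 := Finset.sum_range_succ' (fun k => ‖d (k + 1)‖) m
        rw [hdm (m + 1) (by omega), norm_zero, add_zero] at e1
        have := norm_nonneg (d (0 + 1))
        linarith
      have e (f : ℕ → ℝ) : ∑ k ∈ Finset.Icc 1 m, f k = ∑ k ∈ Finset.range m, f (k + 1) := by
        rw [Finset.range_eq_Ico, Finset.sum_Ico_add' f 0 m 1]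
        rfl
      rw [e, e]
      exact h1
    have hsum := Finset.sum_le_sum fun k (_ : k ∈ Finset.Icc 1 m) => hstep k
    rw [Finset.sum_add_distrib, Finset.sum_add_distrib, ← Finset.mul_sum, ← Finset.sum_div,
      Finset.sum_const, Nat.card_Icc, Nat.add_sub_cancel, nsmul_eq_mul] at hsum
    rw [le_div_iff₀ h1a]
    have h3 := mul_le_mul_of_nonneg_left hshift ha.1.le
    have h4 := div_le_div_of_nonneg_right hV h1a.le
    linarith
  -- The first order part of `Z - 1` turns `i θ * (Z - 1)` into `-θ ^ 2 * a / (1 - a)`; together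
  -- with the Taylor term `-θ ^ 2 / 2` this gives the coefficient `(1 + a) / (2 * (1 - a))`.
  have hid : ∑ k ∈ Finset.Icc 1 m, (Complex.exp (θ k * Complex.I) - 1 - θ k * Complex.I +
        (Complex.exp (θ k * Complex.I) - 1) * (Z k - 1)) +
      (((1 + a) / (2 * (1 - a)) * ∑ k ∈ Finset.Icc 1 m, θ k ^ 2 : ℝ) : ℂ) =
      ∑ k ∈ Finset.Icc 1 m,
        ((Complex.exp (θ k * Complex.I) - 1 - θ k * Complex.I + (θ k : ℂ) ^ 2 / 2) +
        (Complex.exp (θ k * Complex.I) - 1 - θ k * Complex.I) * (Z k - 1) +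
        θ k * Complex.I * d k) := by
    push_cast
    rw [Finset.mul_sum, ← Finset.sum_add_distrib]
    refine Finset.sum_congr rfl fun k _ => ?_
    simp only [hd]
    field_simp
    ring_nf
    rw [Complex.I_sq]
    ring
  rw [hid]
  have hterm (k : ℕ) :
      ‖(Complex.exp (θ k * Complex.I) - 1 - θ k * Complex.I + (θ k : ℂ) ^ 2 / 2) +
        (Complex.exp (θ k * Complex.I) - 1 - θ k * Complex.I) * (Z k - 1) +
        θ k * Complex.I * d k‖ ≤ Θ ^ 3 * (1 + 1 / (1 - a)) + Θ * ‖d k‖ := by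
    refine norm_add₃_le.trans ?_
    have n1 := (hT k).2.2.trans (hp3 k)
    have n2 : ‖(Complex.exp (θ k * Complex.I) - 1 - θ k * Complex.I) * (Z k - 1)‖ ≤
        Θ ^ 2 * (Θ / (1 - a)) := by
      rw [norm_mul]
      exact mul_le_mul ((hT k).2.1.trans (hp2 k)) (hη k) (norm_nonneg _) (by positivity)
    have n3 : ‖θ k * Complex.I * d k‖ ≤ Θ * ‖d k‖ := by
      rw [norm_mul, norm_mul, Complex.norm_I, mul_one, Complex.norm_real, Real.norm_eq_abs]
      exact mul_le_mul_of_nonneg_right (hθ k) (norm_nonneg _)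
    calc _ ≤ Θ ^ 3 + Θ ^ 2 * (Θ / (1 - a)) + Θ * ‖d k‖ := add_le_add (add_le_add n1 n2) n3
      _ = _ := by ring
  refine (norm_sum_le _ _).trans ((Finset.sum_le_sum fun k _ => hterm k).trans ?_)
  rw [Finset.sum_add_distrib, Finset.sum_const, Nat.card_Icc, Nat.add_sub_cancel, nsmul_eq_mul,
    ← Finset.mul_sum]
  have := mul_le_mul_of_nonneg_left hD hΘ0
  refine (add_le_add_right this _).trans (le_of_eq ?_)
  field_simp
  ring

end Recursion

/-- Characteristic function of the centred weighted sums of a stationary INAR(1) path. -/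
lemma integral_exp_centred_inarLaw {lam a : ℝ} (hlam : 0 < lam) (ha : a ∈ Set.Ioo (0 : ℝ) 1)
    {θ : ℕ → ℝ} {m : ℕ} {Z : ℕ → ℂ}
    (hZ : ∀ k, Z k = 1 - a + a * (Complex.exp (θ (k + 1) * Complex.I) * Z (k + 1)))
    (hZm : ∀ k, m ≤ k → Z k = 1) :
    ∫ x, Complex.exp ((∑ k ∈ Finset.Icc 1 m, θ k * ((x k : ℝ) - lam / (1 - a)) : ℝ) * Complex.I)
        ∂(inarLaw lam a) =
      Complex.exp (lam / (1 - a) * ∑ k ∈ Finset.Icc 1 m,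
        (Complex.exp (θ k * Complex.I) - 1 - θ k * Complex.I +
        (Complex.exp (θ k * Complex.I) - 1) * (Z k - 1))) := by
  have h := integral_inarLaw_prod_pow hlam ha (w := fun k => Complex.exp (θ k * Complex.I))
    (fun k => (Complex.norm_exp_ofReal_mul_I _).le) (Z := Z) m (by simp [hZm m le_rfl])
    (fun k _ => hZ k)
  simp only [hZm m le_rfl, one_pow, mul_one, sub_self, zero_add] at h
  have e (x : ℕ → ℕ) :
      Complex.exp ((∑ k ∈ Finset.Icc 1 m, θ k * ((x k : ℝ) - lam / (1 - a)) : ℝ) * Complex.I) =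
      Complex.exp (-(lam / (1 - a) * ∑ k ∈ Finset.Icc 1 m, θ k * Complex.I)) *
        ∏ k ∈ Finset.Icc 1 m, Complex.exp (θ k * Complex.I) ^ x k := by
    simp only [← Complex.exp_nat_mul, ← Complex.exp_sum, ← Complex.exp_add]
    congr 1
    push_cast
    rw [Finset.mul_sum, Finset.sum_mul, ← Finset.sum_neg_distrib, ← Finset.sum_add_distrib]
    exact Finset.sum_congr rfl fun k _ => by ring
  simp only [e, integral_const_mul]
  rw [h, ← Complex.exp_add]
  congr 1
  rw [Finset.mul_sum, Finset.mul_sum, Finset.mul_sum, ← Finset.sum_neg_distrib,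
    ← Finset.sum_add_distrib]
  exact Finset.sum_congr rfl fun k _ => by ring

/-! ### Step weights and the conditional central limit theorem -/

section Weights

variable {ι : Type*} [Fintype ι] (u : ι → ℝ) (t : ι → ℝ≥0)

/-- The covariance form of Brownian motion at the times `t`, evaluated at `u`. -/
noncomputable def brownianForm : ℝ := ∑ i, ∑ j, u i * u j * min (t i : ℝ) (t j)

/-- The total weight `r * ∑ u i` over the times `t i` whose partial sum contains the index `k`. -/
noncomputable def stepWeight (r : ℝ) (n k : ℕ) : ℝ :=
  r * ∑ i, u i * if k ≤ ⌊(n : ℝ) * t i⌋₊ then 1 else 0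

/-- An index beyond all the partial sums considered. -/
noncomputable def horizon (n : ℕ) : ℕ := ∑ i, ⌊(n : ℝ) * t i⌋₊

lemma floor_le_horizon (n : ℕ) (i : ι) : ⌊(n : ℝ) * t i⌋₊ ≤ horizon t n :=
  Finset.single_le_sum (f := fun i => ⌊(n : ℝ) * t i⌋₊) (fun _ _ => Nat.zero_le _)
    (Finset.mem_univ i)

lemma horizon_le (n : ℕ) : (horizon t n : ℝ) ≤ n * ∑ i, (t i : ℝ) := by
  rw [horizon, Nat.cast_sum, Finset.mul_sum]
  exact Finset.sum_le_sum fun i _ => Nat.floor_le (by positivity)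

lemma sum_Icc_ite_le {M p : ℕ} (hp : p ≤ M) (f : ℕ → ℝ) :
    ∑ k ∈ Finset.Icc 1 M, (if k ≤ p then f k else 0) = ∑ k ∈ Finset.Icc 1 p, f k := by
  rw [← Finset.sum_filter]
  congr 1
  ext k
  simp only [Finset.mem_filter, Finset.mem_Icc]
  omega

lemma abs_stepWeight_le (r : ℝ) (n k : ℕ) : |stepWeight u t r n k| ≤ |r| * ∑ i, |u i| := by
  rw [stepWeight, abs_mul]
  refine mul_le_mul_of_nonneg_left ((Finset.abs_sum_le_sum_abs _ _).trans
    (Finset.sum_le_sum fun i _ => ?_)) (abs_nonneg _)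
  split_ifs <;> simp

lemma stepWeight_eq_zero (r : ℝ) (n k : ℕ) (hk : horizon t n < k) : stepWeight u t r n k = 0 := by
  rw [stepWeight, Finset.sum_eq_zero, mul_zero]
  intro i _
  rw [if_neg (by have := floor_le_horizon t n i; omega), mul_zero]

/-- The weight changes between `k` and `k + 1` only when `k` is one of the `⌊n * t i⌋`, so its total
variation is of order `r`, however long the horizon. -/
lemma sum_abs_stepWeight_sub_le (r : ℝ) (n : ℕ) (M : ℕ) :
    ∑ k ∈ Finset.Icc 1 M, |stepWeight u t r n (k + 1) - stepWeight u t r n k| ≤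
      |r| * ∑ i, |u i| := by
  have h (k : ℕ) : |stepWeight u t r n (k + 1) - stepWeight u t r n k| ≤
      |r| * ∑ i, |u i| * if k = ⌊(n : ℝ) * t i⌋₊ then 1 else 0 := by
    rw [stepWeight, stepWeight, ← mul_sub, abs_mul, ← Finset.sum_sub_distrib]
    refine mul_le_mul_of_nonneg_left ((Finset.abs_sum_le_sum_abs _ _).trans
      (Finset.sum_le_sum fun i _ => ?_)) (abs_nonneg _)
    rw [← mul_sub, abs_mul]
    refine mul_le_mul_of_nonneg_left ?_ (abs_nonneg _)
    split_ifs <;> first | omega | simp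
  refine (Finset.sum_le_sum fun k _ => h k).trans ?_
  rw [← Finset.mul_sum, Finset.sum_comm]
  refine mul_le_mul_of_nonneg_left (Finset.sum_le_sum fun i _ => ?_) (abs_nonneg _)
  rw [← Finset.mul_sum]
  refine mul_le_of_le_one_right (abs_nonneg _) ?_
  rw [Finset.sum_ite_eq']
  split_ifs <;> simp

lemma sum_stepWeight_mul (r : ℝ) (n : ℕ) (y : ℕ → ℝ) :
    ∑ k ∈ Finset.Icc 1 (horizon t n), stepWeight u t r n k * y k =
      r * ∑ i, u i * ∑ k ∈ Finset.Icc 1 ⌊(n : ℝ) * t i⌋₊, y k := by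
  simp only [stepWeight, mul_assoc]
  rw [← Finset.mul_sum]
  simp only [Finset.sum_mul]
  rw [Finset.sum_comm]
  congr 1
  refine Finset.sum_congr rfl fun i _ => ?_
  rw [← sum_Icc_ite_le (floor_le_horizon t n i), Finset.mul_sum]
  refine Finset.sum_congr rfl fun k _ => ?_
  split_ifs <;> simp

/-- The indices common to two partial sums number the minimum of the two floors: this is where the
covariance `min s t` of Brownian motion comes from. -/
lemma sum_stepWeight_sq (r : ℝ) (n : ℕ) :
    ∑ k ∈ Finset.Icc 1 (horizon t n), stepWeight u t r n k ^ 2 =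
      r ^ 2 * ∑ i, ∑ j, u i * u j * min (⌊(n : ℝ) * t i⌋₊ : ℝ) ⌊(n : ℝ) * t j⌋₊ := by
  simp only [pow_two]
  rw [sum_stepWeight_mul, mul_assoc]
  congr 1
  rw [Finset.mul_sum]
  refine Finset.sum_congr rfl fun i _ => ?_
  simp only [stepWeight]
  rw [← Finset.mul_sum, Finset.sum_comm, mul_left_comm]
  congr 1
  rw [Finset.mul_sum]
  refine Finset.sum_congr rfl fun j _ => ?_
  rw [← Finset.mul_sum, mul_assoc]
  congr 2
  rw [← Finset.sum_filter, Finset.sum_const, nsmul_eq_mul, mul_one, ← Nat.cast_min]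
  congr 1
  have : Finset.filter (fun k => k ≤ ⌊(n : ℝ) * t j⌋₊) (Finset.Icc 1 ⌊(n : ℝ) * t i⌋₊) =
      Finset.Icc 1 (min ⌊(n : ℝ) * t i⌋₊ ⌊(n : ℝ) * t j⌋₊) := by
    ext k; simp only [Finset.mem_filter, Finset.mem_Icc]; omega
  rw [this, Nat.card_Icc, Nat.add_sub_cancel]

lemma tendsto_sum_stepWeight_sq {r : ℕ → ℝ} {c : ℝ}
    (hrc : Tendsto (fun n : ℕ => n * r n ^ 2) atTop (𝓝 c)) :
    Tendsto (fun n => ∑ k ∈ Finset.Icc 1 (horizon t n), stepWeight u t (r n) n k ^ 2) atTop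
      (𝓝 (c * brownianForm u t)) := by
  have hfl (i : ι) : Tendsto (fun n : ℕ => (⌊(n : ℝ) * t i⌋₊ : ℝ) / n) atTop (𝓝 (t i)) := by
    have := (tendsto_nat_floor_mul_div_atTop (R := ℝ) (a := t i) (t i).2).comp
      tendsto_natCast_atTop_atTop
    simpa [Function.comp_def, mul_comm] using this
  have hsum : Tendsto (fun n : ℕ => (n * r n ^ 2) * ∑ i, ∑ j, u i * u j *
      min ((⌊(n : ℝ) * t i⌋₊ : ℝ) / n) ((⌊(n : ℝ) * t j⌋₊ : ℝ) / n)) atTop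
      (𝓝 (c * brownianForm u t)) :=
    hrc.mul (tendsto_finsetSum _ fun i _ => tendsto_finsetSum _ fun j _ =>
      ((hfl i).min (hfl j)).const_mul _)
  refine hsum.congr' ?_
  filter_upwards [eventually_gt_atTop 0] with n hn
  have hn' : (0 : ℝ) < n := by exact_mod_cast hn
  rw [sum_stepWeight_sq, mul_comm (n : ℝ), mul_assoc, Finset.mul_sum]
  congr 1
  refine Finset.sum_congr rfl fun i _ => ?_
  rw [Finset.mul_sum]
  refine Finset.sum_congr rfl fun j _ => ?_
  rw [min_div_div_right hn'.le]
  field_simp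

/-- Conditional central limit theorem: the finite-dimensional distributions of the normalised
centred partial sums of a stationary INAR(1) process converge to those of a multiple of Brownian
motion, in terms of characteristic functions. -/
theorem tendsto_integral_exp_inarLaw {lam a : ℝ} (hlam : 0 < lam) (ha : a ∈ Set.Ioo (0 : ℝ) 1)
    {r : ℕ → ℝ} {c : ℝ} (hr : Tendsto r atTop (𝓝 0))
    (hrc : Tendsto (fun n : ℕ => n * r n ^ 2) atTop (𝓝 c)) :
    Tendsto (fun n : ℕ => ∫ x, Complex.exp ((r n * ∑ i, u i *
        ∑ k ∈ Finset.Icc 1 ⌊(n : ℝ) * t i⌋₊, ((x k : ℝ) - lam / (1 - a)) : ℝ) * Complex.I)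
        ∂(inarLaw lam a)) atTop
      (𝓝 (Complex.exp (-(c * brownianForm u t * lam / 2 * ((1 + a) / (1 - a) ^ 2)) : ℝ))) := by
  have h1a : (0 : ℝ) < 1 - a := by linarith [ha.2]
  set K := ∑ i, |u i| with hK
  set w : ℕ → ℕ → ℂ := fun n k => Complex.exp (stepWeight u t (r n) n k * Complex.I) with hw
  have hsol (n : ℕ) := exists_backward_solution (w := w n) (m := horizon t n) ha
    (fun k => (Complex.norm_exp_ofReal_mul_I _).le)
    (fun k hk => by simp [hw, stepWeight_eq_zero u t (r n) n k hk])
  choose Z hZ hZm _ using hsol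
  set L : ℕ → ℂ := fun n => ∑ k ∈ Finset.Icc 1 (horizon t n),
    (w n k - 1 - stepWeight u t (r n) n k * Complex.I + (w n k - 1) * (Z n k - 1)) with hL
  have hint (n : ℕ) : ∫ x, Complex.exp ((r n * ∑ i, u i *
        ∑ k ∈ Finset.Icc 1 ⌊(n : ℝ) * t i⌋₊, ((x k : ℝ) - lam / (1 - a)) : ℝ) * Complex.I)
        ∂(inarLaw lam a) = Complex.exp (lam / (1 - a) * L n) := by
    rw [← integral_exp_centred_inarLaw hlam ha (hZ n) (hZm n)]
    refine integral_congr_ae (Eventually.of_forall fun x => ?_)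
    simp only
    rw [sum_stepWeight_mul]
  simp only [hint]
  have hS := tendsto_sum_stepWeight_sq u t hrc
  set S : ℕ → ℝ := fun n => (1 + a) / (2 * (1 - a)) *
    ∑ k ∈ Finset.Icc 1 (horizon t n), stepWeight u t (r n) n k ^ 2 with hSdef
  have hS' : Tendsto S atTop (𝓝 ((1 + a) / (2 * (1 - a)) * (c * brownianForm u t))) :=
    hS.const_mul _
  have habs : Tendsto (fun n => |r n|) atTop (𝓝 0) := by simpa using hr.abs
  have hsmall : Tendsto (fun n => |r n| * K) atTop (𝓝 0) := by simpa using habs.mul_const K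
  have hdiff : Tendsto (fun n => L n + (S n : ℂ)) atTop (𝓝 0) := by
    -- The horizon is at most `n * ∑ t i`, the weights are at most `|r n| * K`, and so is their
    -- total variation. As `n * r n ^ 2` converges, the cubic error is `O(|r n|)` and the variation
    -- error is `O(r n ^ 2)`.
    have hbound : Tendsto (fun n : ℕ => (n * r n ^ 2) * ((∑ i, (t i : ℝ)) * K ^ 3 *
        (1 + 1 / (1 - a)) ^ 2) * |r n| + |r n| ^ 2 * (K ^ 2 / (1 - a) ^ 2)) atTop (𝓝 0) := by
      simpa using ((hrc.mul_const _).mul habs).add ((habs.pow 2).mul_const (K ^ 2 / (1 - a) ^ 2))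
    refine squeeze_zero_norm' ?_ hbound
    filter_upwards [hsmall.eventually (eventually_le_nhds zero_lt_one)] with n hn
    have h := norm_logChar_add_le ha hn (abs_stepWeight_le u t (r n) n)
      (stepWeight_eq_zero u t (r n) n) (sum_abs_stepWeight_sub_le u t (r n) n (horizon t n))
      (hZ n) (hZm n)
    refine h.trans ?_
    have hM := horizon_le t n
    have hnn : 0 ≤ (|r n| * K) ^ 3 * (1 + 1 / (1 - a)) ^ 2 := by positivity
    have := mul_le_mul_of_nonneg_right hM hnn
    calc _ = (horizon t n : ℝ) * ((|r n| * K) ^ 3 * (1 + 1 / (1 - a)) ^ 2) +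
          |r n| ^ 2 * (K ^ 2 / (1 - a) ^ 2) := by ring
      _ ≤ n * (∑ i, (t i : ℝ)) * ((|r n| * K) ^ 3 * (1 + 1 / (1 - a)) ^ 2) +
          |r n| ^ 2 * (K ^ 2 / (1 - a) ^ 2) := by linarith
      _ = _ := by rw [← sq_abs (r n)]; ring
  have hlim : Tendsto L atTop
      (𝓝 (-(((1 + a) / (2 * (1 - a)) * (c * brownianForm u t) : ℝ) : ℂ))) := by
    have := hdiff.sub ((Complex.continuous_ofReal.tendsto _).comp hS')
    simpa using this
  have h2 := (hlim.const_mul (lam / (1 - a) : ℂ)).cexp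
  convert h2 using 3
  push_cast
  have : (1 - a : ℂ) ≠ 0 := by exact_mod_cast h1a.ne'
  field_simp

end Weights

/-! ### The heavy-tailed random variance and its Laplace transform -/

/-- The shape of the long-run variance of the stationary INAR(1) process as a function of the
thinning parameter. -/
noncomputable def varShape (a : ℝ) : ℝ := (1 + a) / (1 - a) ^ 2

lemma measurable_varShape : Measurable varShape := by unfold varShape; fun_prop

lemma varShape_nonneg {a : ℝ} (ha : a ∈ Set.Ioo (0 : ℝ) 1) : 0 ≤ varShape a :=
  div_nonneg (by linarith [ha.1]) (sq_nonneg _)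

/-- In the variable `y = 1 - x` the variance shape is `(2 - y) / y ^ 2`, so the exponent is of order
one at `y = √c`, where the integral is split. Below `√c` the integrand is at most `y`, contributing
at most `c / 2`. Above, linearising the exponential gives `2 * c / y - c`, and `2 * c / y`
integrates to `c * log (1 / c)`. -/
lemma abs_integral_one_sub_exp_sub_le {c : ℝ} (hc : c ∈ Set.Ioo (0 : ℝ) 1) :
    |(∫ y in (0 : ℝ)..1, y * (1 - Real.exp (-(c * ((2 - y) / y ^ 2))))) - c * Real.log c⁻¹| ≤
      2 * c := by
  obtain ⟨hc0, hc1⟩ := hc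
  set s := Real.sqrt c with hs
  have hs0 : 0 < s := Real.sqrt_pos.2 hc0
  have hs1 : s < 1 := by rw [hs, Real.sqrt_lt' one_pos]; simpa using hc1
  have hsq : s ^ 2 = c := Real.sq_sqrt hc0.le
  have hlog : Real.log c⁻¹ = -(2 * Real.log s) := by
    rw [← hsq, Real.log_inv, Real.log_pow]; push_cast; ring
  set F : ℝ → ℝ := fun y => y * (1 - Real.exp (-(c * ((2 - y) / y ^ 2)))) with hF
  have hFm : Measurable F := by fun_prop
  have hz (y : ℝ) (hy : y ∈ Set.Icc (0 : ℝ) 1) : 0 ≤ c * ((2 - y) / y ^ 2) :=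
    mul_nonneg hc0.le (div_nonneg (by linarith [hy.2]) (sq_nonneg _))
  have hF0 (y : ℝ) (hy : y ∈ Set.Icc (0 : ℝ) 1) : 0 ≤ F y :=
    mul_nonneg hy.1 (by have := Real.exp_le_one_iff.2 (neg_nonpos.2 (hz y hy)); linarith)
  have hFy (y : ℝ) (hy : y ∈ Set.Icc (0 : ℝ) 1) : F y ≤ y :=
    mul_le_of_le_one_right hy.1 (by have := Real.exp_pos (-(c * ((2 - y) / y ^ 2))); linarith)
  have hFint (p q : ℝ) (hp : 0 ≤ p) (hpq : p ≤ q) (hq : q ≤ 1) : IntervalIntegrable F volume p q := by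
    refine (intervalIntegrable_const (c := (1 : ℝ))).mono_fun hFm.aestronglyMeasurable ?_
    refine (ae_restrict_iff' measurableSet_uIoc).2 (Eventually.of_forall fun y hy => ?_)
    rw [Set.uIoc_of_le hpq] at hy
    have hy' : y ∈ Set.Icc (0 : ℝ) 1 := ⟨hp.trans hy.1.le, hy.2.trans hq⟩
    simp only [norm_one]
    rw [Real.norm_eq_abs, abs_of_nonneg (hF0 y hy')]
    exact (hFy y hy').trans hy'.2
  have hi1 := hFint 0 s le_rfl hs0.le hs1.le
  have hi2 := hFint s 1 hs0.le hs1.le le_rfl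
  have hsplit := intervalIntegral.integral_add_adjacent_intervals hi1 hi2
  -- near the singularity
  have hA0 : 0 ≤ ∫ y in (0 : ℝ)..s, F y :=
    intervalIntegral.integral_nonneg hs0.le fun y hy => hF0 y ⟨hy.1, hy.2.trans hs1.le⟩
  have hA1 : ∫ y in (0 : ℝ)..s, F y ≤ c / 2 := by
    have h := intervalIntegral.integral_mono_on hs0.le hi1 intervalIntegral.intervalIntegrable_id
      fun y hy => hFy y ⟨hy.1, hy.2.trans hs1.le⟩
    rw [integral_id, hsq] at h
    simpa using h
  -- away from the singularity
  have hcont (f : ℝ → ℝ) (hf : ContinuousOn f (Set.Icc s 1)) : IntervalIntegrable f volume s 1 :=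
    ContinuousOn.intervalIntegrable (by rwa [Set.uIcc_of_le hs1.le])
  have hB1 : ∫ y in s..1, F y ≤ c * Real.log c⁻¹ := by
    have h := intervalIntegral.integral_mono_on hs1.le hi2
      (hcont (fun y => 2 * c * y⁻¹) (ContinuousOn.mul continuousOn_const
        (continuousOn_inv₀.mono fun y hy => (hs0.trans_le hy.1).ne'))) fun y hy => by
        have hy0 : 0 < y := hs0.trans_le hy.1
        have h1 := Real.add_one_le_exp (-(c * ((2 - y) / y ^ 2)))
        calc F y ≤ y * (c * ((2 - y) / y ^ 2)) :=
              mul_le_mul_of_nonneg_left (by linarith) hy0.le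
          _ = (2 * c * y⁻¹) - c := by field_simp
          _ ≤ _ := by linarith
    rw [intervalIntegral.integral_const_mul, integral_inv_of_pos hs0 one_pos, one_div,
      Real.log_inv] at h
    rw [hlog]
    linarith
  have hB2 : c * Real.log c⁻¹ - 2 * c ≤ ∫ y in s..1, F y := by
    -- A primitive of the lower bound `g` obtained from `1 - exp (-z) ≥ z - z ^ 2 / 2` and `y * z ^
    -- 2 / 2 ≤ 2 * c ^ 2 / y ^ 3`. At `y = √c` the last term of `G` equals `c`, the order of the
    -- allowed error.
    set G : ℝ → ℝ := fun y => 2 * c * Real.log y - c * y + c ^ 2 * (y ^ 2)⁻¹ with hG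
    set g : ℝ → ℝ := fun y => 2 * c * y⁻¹ - c - 2 * c ^ 2 * (y ^ 3)⁻¹ with hg
    have hgi : IntervalIntegrable g volume s 1 := by
      refine hcont g fun y hy => ?_
      have hy0 : y ≠ 0 := (hs0.trans_le hy.1).ne'
      have hy3 : y ^ 3 ≠ 0 := pow_ne_zero 3 hy0
      exact ContinuousAt.continuousWithinAt (by fun_prop (disch := assumption))
    have hder : ∀ y ∈ Set.uIcc s 1, HasDerivAt G (g y) y := by
      intro y hy
      rw [Set.uIcc_of_le hs1.le] at hy
      have hy0 : y ≠ 0 := (hs0.trans_le hy.1).ne'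
      have h1 := ((Real.hasDerivAt_log hy0).const_mul (2 * c)).sub ((hasDerivAt_id y).const_mul c)
      have h2 := (((hasDerivAt_pow 2 y).inv (pow_ne_zero 2 hy0)).const_mul (c ^ 2))
      refine (h1.add h2).congr_deriv ?_
      simp only [hg]
      field_simp
      ring
    have hFTC := intervalIntegral.integral_eq_sub_of_hasDerivAt hder hgi
    have h := intervalIntegral.integral_mono_on hs1.le hgi hi2 fun y hy => by
      have hy0 : 0 < y := hs0.trans_le hy.1
      set z := c * ((2 - y) / y ^ 2) with hzdef
      have hz0 : 0 ≤ z := hz y ⟨hy0.le, hy.2⟩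
      -- This follows from `exp z ≥ 1 + z + z ^ 2 / 2` and `(1 - z + z ^ 2 / 2) * (1 + z + z ^ 2 /
      -- 2) = 1 + z ^ 4 / 4`.
      have hexp : Real.exp (-z) ≤ 1 - z + z ^ 2 / 2 := by
        have h3 := Real.quadratic_le_exp_of_nonneg hz0
        have h4 : Real.exp (-z) * Real.exp z = 1 := by rw [← Real.exp_add]; simp
        have h5 := Real.exp_pos (-z)
        have h6 : 0 ≤ 1 - z + z ^ 2 / 2 := by nlinarith [sq_nonneg (z - 1)]
        have h7 : 1 ≤ (1 - z + z ^ 2 / 2) * (1 + z + z ^ 2 / 2) := by nlinarith [sq_nonneg (z ^ 2)]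
        have h8 : 1 ≤ (1 - z + z ^ 2 / 2) * Real.exp z :=
          h7.trans (mul_le_mul_of_nonneg_left h3 h6)
        rw [Real.exp_neg]
        rw [inv_le_iff_one_le_mul₀ (Real.exp_pos z)]
        exact h8
      have hz2 : y * z ≥ 2 * c * y⁻¹ - c := by
        rw [hzdef]; apply le_of_eq; field_simp
      have hz3 : y * (z ^ 2 / 2) ≤ 2 * c ^ 2 * (y ^ 3)⁻¹ := by
        have : y * (z ^ 2 / 2) = (2 - y) ^ 2 / 2 * (c ^ 2 * (y ^ 3)⁻¹) := by
          rw [hzdef]; field_simp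
        rw [this]
        have h9 : 0 ≤ c ^ 2 * (y ^ 3)⁻¹ := by positivity
        have h10 : (2 - y) ^ 2 / 2 ≤ 2 := by nlinarith [hy.2]
        nlinarith
      calc g y ≤ y * z - y * (z ^ 2 / 2) := by simp only [hg]; linarith
        _ = y * (1 - (1 - z + z ^ 2 / 2)) := by ring
        _ ≤ F y := mul_le_mul_of_nonneg_left (by linarith) hy0.le
    rw [hFTC] at h
    refine le_trans ?_ h
    simp only [hG, Real.log_one, hsq, hlog]
    have : c ^ 2 * c⁻¹ = c := by field_simp
    rw [this]
    nlinarith [sq_nonneg c, mul_pos hc0 hs0]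
  rw [abs_le]
  constructor <;> linarith

/-- A heavy-tailed Laplace transform: mixing the variance shape over a density with a positive limit
at `1` gives the boundary case of the domain of attraction, with a logarithmic correction. -/
theorem tendsto_integral_one_sub_exp_div {ψ : ℝ → ℝ} {ψ₁ : ℝ}
    (hψ_nonneg : ∀ x ∈ Set.Ioo (0 : ℝ) 1, 0 ≤ ψ x)
    (hψ_int : IntegrableOn ψ (Set.Ioo 0 1)) (hψ_lim : Tendsto ψ (𝓝[<] 1) (𝓝 ψ₁)) :
    Tendsto (fun c : ℝ => (∫ x, (1 - Real.exp (-(c * varShape x)))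
        ∂((volume.restrict (Set.Ioo (0 : ℝ) 1)).withDensity
          fun x => ENNReal.ofReal (ψ x * (1 - x)))) / (c * Real.log c⁻¹))
      (𝓝[>] 0) (𝓝 ψ₁) := by
  set φ : ℝ → ℝ → ℝ := fun c x =>
    ((1 - x) * (1 - Real.exp (-(c * varShape x)))) / (c * Real.log c⁻¹) with hφ
  have hIoo : Set.Ioo (0 : ℝ) 1 ∈ 𝓝[>] (0 : ℝ) := Ioo_mem_nhdsGT one_pos
  have hlogpos (c : ℝ) (hc : c ∈ Set.Ioo (0 : ℝ) 1) : 0 < Real.log c⁻¹ :=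
    Real.log_pos ((one_lt_inv₀ hc.1).2 hc.2)
  have hloginf : Tendsto (fun c : ℝ => Real.log c⁻¹) (𝓝[>] 0) atTop :=
    Real.tendsto_log_atTop.comp tendsto_inv_nhdsGT_zero
  have hnhds : 𝓝[Set.Ioo (0 : ℝ) 1] (1 : ℝ) = 𝓝[<] 1 := nhdsWithin_Ioo_eq_nhdsLT one_pos
  have hφ0 (c : ℝ) (hc : c ∈ Set.Ioo (0 : ℝ) 1) (x : ℝ) (hx : x ∈ Set.Ioo (0 : ℝ) 1) :
      0 ≤ φ c x := by
    refine div_nonneg (mul_nonneg (by linarith [hx.2]) ?_) (mul_pos hc.1 (hlogpos c hc)).le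
    have := Real.exp_le_one_iff.2 (neg_nonpos.2 (mul_nonneg hc.1.le (varShape_nonneg hx)))
    linarith
  -- As `c` decreases to `0` the kernels `φ c` form an approximate identity at the endpoint `1`:
  -- their mass tends to `1` by the preceding estimate, and at distance `≥ δ` from `1` they are at
  -- most `2 / (δ ^ 2 * log (1 / c))`. Integrating against `ψ` therefore picks out its left limit.
  have key : Tendsto (fun c : ℝ => ∫ x in Set.Ioo (0 : ℝ) 1, φ c x • ψ x) (𝓝[>] 0) (𝓝 ψ₁) := by
    refine tendsto_setIntegral_peak_smul_of_integrableOn_of_tendsto (x₀ := 1) measurableSet_Ioo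
      measurableSet_Ioo subset_rfl self_mem_nhdsWithin (by simp) ?_ ?_ ?_ ?_ hψ_int
      (by rwa [hnhds])
    · filter_upwards [hIoo] with c hc x hx using hφ0 c hc x hx
    · intro U hU h1U
      obtain ⟨δ, hδ, hball⟩ := Metric.isOpen_iff.1 hU 1 h1U
      rw [Metric.tendstoUniformlyOn_iff]
      intro e he
      have h2 : Tendsto (fun c : ℝ => 2 / δ ^ 2 * (Real.log c⁻¹)⁻¹) (𝓝[>] 0) (𝓝 0) := by
        simpa using (tendsto_inv_atTop_zero.comp hloginf).const_mul (2 / δ ^ 2)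
      filter_upwards [hIoo, h2.eventually (gt_mem_nhds he)] with c hc hce x hx
      simp only [Pi.zero_apply, dist_zero_left, Real.norm_eq_abs]
      rw [abs_of_nonneg (hφ0 c hc x hx.1)]
      refine lt_of_le_of_lt ?_ hce
      obtain ⟨⟨hx0, hx1⟩, hxU⟩ := hx
      have hxδ : δ ≤ 1 - x := by
        by_contra hlt
        refine hxU (hball ?_)
        rw [Metric.mem_ball, Real.dist_eq, abs_sub_comm, abs_of_pos (by linarith)]
        linarith
      have h1x : 0 < 1 - x := by linarith
      have hV : varShape x ≤ 2 / δ ^ 2 := by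
        unfold varShape
        gcongr
        linarith
      have hexp := Real.add_one_le_exp (-(c * varShape x))
      have hnum : (1 - x) * (1 - Real.exp (-(c * varShape x))) ≤ c * (2 / δ ^ 2) := by
        have h4 : 1 - Real.exp (-(c * varShape x)) ≤ c * (2 / δ ^ 2) := by
          have := mul_le_mul_of_nonneg_left hV hc.1.le
          linarith
        have h5 : 0 ≤ c * (2 / δ ^ 2) := mul_nonneg hc.1.le (by positivity)
        nlinarith
      have hl := hlogpos c hc
      calc φ c x ≤ c * (2 / δ ^ 2) / (c * Real.log c⁻¹) :=
            div_le_div_of_nonneg_right hnum (mul_pos hc.1 hl).le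
        _ = _ := by have := hc.1.ne'; field_simp
    · have h1 (c : ℝ) : ∫ x in Set.Ioo (0 : ℝ) 1, φ c x =
          (∫ y in (0 : ℝ)..1, y * (1 - Real.exp (-(c * ((2 - y) / y ^ 2))))) /
            (c * Real.log c⁻¹) := by
        rw [← integral_Ioc_eq_integral_Ioo, ← intervalIntegral.integral_of_le zero_le_one]
        simp only [hφ]
        rw [intervalIntegral.integral_div]
        congr 1
        have := intervalIntegral.integral_comp_sub_left (a := 0) (b := 1)
          (fun y : ℝ => y * (1 - Real.exp (-(c * ((2 - y) / y ^ 2))))) 1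
        simp only [sub_self, sub_zero] at this
        rw [← this]
        refine intervalIntegral.integral_congr fun x _ => ?_
        simp only [varShape]
        ring_nf
      have h2 : Tendsto (fun c : ℝ => 2 * (Real.log c⁻¹)⁻¹) (𝓝[>] 0) (𝓝 0) := by
        simpa using (tendsto_inv_atTop_zero.comp hloginf).const_mul 2
      rw [tendsto_iff_norm_sub_tendsto_zero]
      refine squeeze_zero' (Eventually.of_forall fun _ => norm_nonneg _) ?_ h2
      filter_upwards [hIoo] with c hc
      have hl := hlogpos c hc
      have hcl := mul_pos hc.1 hl
      rw [h1, Real.norm_eq_abs, div_sub_one hcl.ne', abs_div, abs_of_pos hcl, div_le_iff₀ hcl]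
      refine (abs_integral_one_sub_exp_sub_le hc).trans (le_of_eq ?_)
      generalize Real.log c⁻¹ = l at hl
      field_simp
    · refine Eventually.of_forall fun c => ?_
      have := measurable_varShape
      exact Measurable.aestronglyMeasurable (by simp only [hφ]; fun_prop)
  refine key.congr fun c => ?_
  have hm : AEMeasurable (fun x => ENNReal.ofReal (ψ x * (1 - x)))
      (volume.restrict (Set.Ioo (0 : ℝ) 1)) :=
    (hψ_int.aestronglyMeasurable.aemeasurable.mul (by fun_prop)).ennreal_ofReal
  rw [integral_withDensity_eq_integral_toReal_smul₀ hm (by simp), ← integral_div]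
  refine setIntegral_congr_fun measurableSet_Ioo fun x hx => ?_
  simp only [hφ, smul_eq_mul]
  rw [ENNReal.toReal_ofReal (mul_nonneg (hψ_nonneg x hx) (by linarith [hx.2]))]
  ring

/-- The Laplace transform of the normalised sum of `N` independent copies of the variance shape
converges to that of the constant `ψ₁`. -/
theorem tendsto_integral_exp_neg_pow {ψ : ℝ → ℝ} {ψ₁ : ℝ} {μ : Measure ℝ} [IsProbabilityMeasure μ]
    (hψ_nonneg : ∀ x ∈ Set.Ioo (0 : ℝ) 1, 0 ≤ ψ x)
    (hψ_int : IntegrableOn ψ (Set.Ioo 0 1)) (hψ_lim : Tendsto ψ (𝓝[<] 1) (𝓝 ψ₁))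
    (hμ : μ = (volume.restrict (Set.Ioo (0 : ℝ) 1)).withDensity
          fun x => ENNReal.ofReal (ψ x * (1 - x))) {κ : ℝ} (hκ : 0 ≤ κ) :
    Tendsto (fun N : ℕ => (∫ x, Real.exp (-(κ / (N * Real.log N) * varShape x)) ∂μ) ^ N) atTop
      (𝓝 (Real.exp (-(κ * ψ₁)))) := by
  -- The case `κ = 0` is separate because the asymptotics below need `c` to approach `0` through
  -- positive values.
  rcases hκ.eq_or_lt with rfl | hκ
  · simp
  have hsupp : ∀ᵐ x ∂μ, x ∈ Set.Ioo (0 : ℝ) 1 := by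
    rw [hμ]
    exact (withDensity_absolutelyContinuous _ _).ae_le (ae_restrict_mem measurableSet_Ioo)
  set f : ℝ → ℝ := fun c => ∫ x, (1 - Real.exp (-(c * varShape x))) ∂μ with hf
  have hmain := tendsto_integral_one_sub_exp_div hψ_nonneg hψ_int hψ_lim
  rw [← hμ] at hmain
  have hlogN : Tendsto (fun N : ℕ => Real.log N) atTop atTop :=
    Real.tendsto_log_atTop.comp tendsto_natCast_atTop_atTop
  have hNlog : Tendsto (fun N : ℕ => (N : ℝ) * Real.log N) atTop atTop :=
    tendsto_natCast_atTop_atTop.atTop_mul_atTop₀ hlogN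
  set c : ℕ → ℝ := fun N => κ / (N * Real.log N) with hc
  have hc0 : Tendsto c atTop (𝓝[>] 0) := by
    refine tendsto_nhdsWithin_iff.2 ⟨tendsto_const_nhds.div_atTop hNlog, ?_⟩
    filter_upwards [hNlog.eventually_gt_atTop 0] with N hN using div_pos hκ hN
  -- Here `log (1 / c N) = log N + log log N - log κ ~ log N`, which cancels the `log N` in the
  -- normalisation.
  have hratio : Tendsto (fun N : ℕ => N * (c N * Real.log (c N)⁻¹)) atTop (𝓝 κ) := by
    have h1 : Tendsto (fun N : ℕ => Real.log (Real.log N) / Real.log N) atTop (𝓝 0) :=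
      (Real.isLittleO_log_id_atTop.tendsto_div_nhds_zero).comp hlogN
    have h2 : Tendsto (fun N : ℕ => Real.log κ / Real.log N) atTop (𝓝 0) :=
      tendsto_const_nhds.div_atTop hlogN
    have h3 : Tendsto (fun N : ℕ => κ * (1 + Real.log (Real.log N) / Real.log N -
        Real.log κ / Real.log N)) atTop (𝓝 κ) := by
      simpa using ((tendsto_const_nhds (x := (1 : ℝ))).add h1 |>.sub h2).const_mul κ
    refine h3.congr' ?_
    filter_upwards [eventually_gt_atTop 0, hlogN.eventually_gt_atTop 0] with N hN hl
    have hN' : (0 : ℝ) < N := by exact_mod_cast hN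
    simp only [hc]
    rw [inv_div, Real.log_div (by positivity) hκ.ne', Real.log_mul hN'.ne' hl.ne']
    field_simp
  have hNf : Tendsto (fun N : ℕ => N * f (c N)) atTop (𝓝 (κ * ψ₁)) := by
    refine (hratio.mul (hmain.comp hc0)).congr' ?_
    have hne : ∀ᶠ N in atTop, c N * Real.log (c N)⁻¹ ≠ 0 := by
      filter_upwards [hc0.eventually (Ioo_mem_nhdsGT one_pos)] with N hN
      exact (mul_pos hN.1 (Real.log_pos ((one_lt_inv₀ hN.1).2 hN.2))).ne'
    filter_upwards [hne] with N hN
    simp only [Function.comp_apply, hf]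
    generalize c N * Real.log (c N)⁻¹ = D at hN
    field_simp
  have hpow := Real.tendsto_one_add_pow_exp_of_tendsto (g := fun N => -f (c N)) (t := -(κ * ψ₁))
    (by simpa using hNf.neg)
  refine hpow.congr' ?_
  filter_upwards [hc0.eventually self_mem_nhdsWithin] with N hN
  have hint : Integrable (fun x => Real.exp (-(c N * varShape x))) μ := by
    have := measurable_varShape
    refine Integrable.of_bound (Measurable.aestronglyMeasurable (by fun_prop)) 1 ?_
    filter_upwards [hsupp] with x hx
    rw [Real.norm_eq_abs, Real.abs_exp, Real.exp_le_one_iff]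
    exact neg_nonpos.2 (mul_nonneg (le_of_lt hN) (varShape_nonneg hx))
  simp only [hf]
  rw [integral_sub (integrable_const _) hint]
  simp [hc]

/-! ### Mixing over the random thinning parameter -/

section Mixing

variable {Ω : Type*} [MeasurableSpace Ω] {P : Measure Ω} [IsProbabilityMeasure P] {lam : ℝ}
  {ψ : ℝ → ℝ} {α : Ω → ℝ} {X : ℕ → Ω → ℕ}

/-- The factor `1 - x` of the density cancels the pole, leaving the integrable `ψ`. This makes the
process integrable, so that its conditional expectation is not the default value `0`. -/
lemma integrable_div_one_sub_withDensity (lam : ℝ)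
    (hψ_nonneg : ∀ x ∈ Set.Ioo (0 : ℝ) 1, 0 ≤ ψ x) (hψ_int : IntegrableOn ψ (Set.Ioo 0 1)) :
    Integrable (fun a => lam / (1 - a)) ((volume.restrict (Set.Ioo (0 : ℝ) 1)).withDensity
      fun x => ENNReal.ofReal (ψ x * (1 - x))) := by
  have hm : AEMeasurable (fun x => ENNReal.ofReal (ψ x * (1 - x)))
      (volume.restrict (Set.Ioo (0 : ℝ) 1)) :=
    (hψ_int.aestronglyMeasurable.aemeasurable.mul (by fun_prop)).ennreal_ofReal
  rw [integrable_withDensity_iff_integrable_smul₀' hm (by simp)]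
  refine (hψ_int.const_mul lam).congr ?_
  filter_upwards [ae_restrict_mem measurableSet_Ioo] with x hx
  have h1x : 0 < 1 - x := by linarith [hx.2]
  rw [ENNReal.toReal_ofReal (mul_nonneg (hψ_nonneg x hx) h1x.le), smul_eq_mul]
  field_simp

namespace IsRandomizedINAR

lemma measurable_path (hX : IsRandomizedINAR lam α X P) : Measurable fun ω k => X k ω :=
  measurable_pi_lambda _ hX.measurable_process

lemma ae_map_mem_Ioo (hX : IsRandomizedINAR lam α X P) :
    ∀ᵐ a ∂(P.map α), a ∈ Set.Ioo (0 : ℝ) 1 :=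
  (ae_map_iff hX.measurable_param.aemeasurable measurableSet_Ioo).2 hX.param_mem

/-- The conditional expectation of the process given the thinning parameter. -/
lemma condExp_eq (hlam : 0 < lam) (hX : IsRandomizedINAR lam α X P)
    (hint : Integrable (fun a => lam / (1 - a)) (P.map α)) (k : ℕ) :
    P[fun ω => (X k ω : ℝ) | MeasurableSpace.comap α inferInstance] =ᵐ[P]
      fun ω => lam / (1 - α ω) := by
  have hY := hX.measurable_path
  have hf : Measurable fun x : ℕ → ℕ => (x k : ℝ) := by fun_prop
  have hmean : ∀ᵐ a ∂(P.map α), Integrable (fun x : ℕ → ℕ => (x k : ℝ))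
      (condDistrib (fun ω k => X k ω) α P a) ∧
      ∫ x, (x k : ℝ) ∂(condDistrib (fun ω k => X k ω) α P a) = lam / (1 - a) := by
    filter_upwards [hX.condLaw, hX.ae_map_mem_Ioo] with a ha h01
    rw [ha]
    exact integrable_eval_inarLaw hlam h01 k
  have hint2 : Integrable (fun p : ℝ × (ℕ → ℕ) => (p.2 k : ℝ))
      (P.map fun ω => (α ω, fun k => X k ω)) := by
    rw [← AEStronglyMeasurable.ae_integrable_condDistrib_map_iff hY.aemeasurable
      (Measurable.aestronglyMeasurable (by fun_prop))]
    refine ⟨hmean.mono fun a h => h.1, hint.congr ?_⟩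
    filter_upwards [hmean] with a h
    rw [← h.2]
    simp
  have hint3 : Integrable (fun ω => (X k ω : ℝ)) P :=
    hint2.comp_measurable (hX.measurable_param.prodMk hY)
  have h := condExp_ae_eq_integral_condDistrib (f := fun x : ℕ → ℕ => (x k : ℝ))
    hX.measurable_param hY.aemeasurable hf.stronglyMeasurable hint3
  refine h.trans ?_
  filter_upwards [ae_of_ae_map hX.measurable_param.aemeasurable hmean] with ω hω using hω.2

variable {ι : Type*} [Fintype ι]

/-- Limit of the characteristic function of the partial sums of a single randomised copy. -/
lemma tendsto_integral_exp (hlam : 0 < lam) (hX : IsRandomizedINAR lam α X P)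
    (u : ι → ℝ) (t : ι → ℝ≥0) {r : ℕ → ℝ} {c : ℝ} (hr : Tendsto r atTop (𝓝 0))
    (hrc : Tendsto (fun n : ℕ => n * r n ^ 2) atTop (𝓝 c)) :
    Tendsto (fun n : ℕ => ∫ ω, Complex.exp ((r n * ∑ i, u i *
        ∑ k ∈ Finset.Icc 1 ⌊(n : ℝ) * t i⌋₊, ((X k ω : ℝ) - lam / (1 - α ω)) : ℝ) * Complex.I) ∂P)
      atTop (𝓝 (∫ a, (Real.exp (-(c * brownianForm u t * lam / 2 * varShape a)) : ℂ)
        ∂(P.map α))) := by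
  have hY := hX.measurable_path
  set G : ℕ → ℝ × (ℕ → ℕ) → ℂ := fun n p => Complex.exp ((r n * ∑ i, u i *
    ∑ k ∈ Finset.Icc 1 ⌊(n : ℝ) * t i⌋₊, ((p.2 k : ℝ) - lam / (1 - p.1)) : ℝ) * Complex.I) with hG
  have hGm (n : ℕ) : Measurable (G n) := by
    simp only [hG]; fun_prop
  have hGn (n : ℕ) (p) : ‖G n p‖ = 1 := Complex.norm_exp_ofReal_mul_I _
  have hprod (n : ℕ) : ∫ ω, G n (α ω, fun k => X k ω) ∂P =
      ∫ a, ∫ x, G n (a, x) ∂(condDistrib (fun ω k => X k ω) α P a) ∂(P.map α) := by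
    have hmap : AEMeasurable (fun ω => (α ω, fun k => X k ω)) P :=
      (hX.measurable_param.prodMk hY).aemeasurable
    rw [← integral_map (f := G n) hmap (hGm n).aestronglyMeasurable,
      ← compProd_map_condDistrib hY.aemeasurable]
    refine Measure.integral_compProd (Integrable.of_bound (hGm n).aestronglyMeasurable 1
      (Eventually.of_forall fun p => (hGn n p).le))
  have hprod' : ∀ n : ℕ, ∫ ω, Complex.exp ((r n * ∑ i, u i *
        ∑ k ∈ Finset.Icc 1 ⌊(n : ℝ) * t i⌋₊, ((X k ω : ℝ) - lam / (1 - α ω)) : ℝ) * Complex.I) ∂P =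
      ∫ a, ∫ x, G n (a, x) ∂(condDistrib (fun ω k => X k ω) α P a) ∂(P.map α) := hprod
  simp only [hprod']
  have : IsProbabilityMeasure (P.map α) :=
    Measure.isProbabilityMeasure_map hX.measurable_param.aemeasurable
  refine tendsto_integral_of_dominated_convergence (fun _ => 1)
    (fun n => (hGm n).stronglyMeasurable.integral_condDistrib.aestronglyMeasurable)
    (integrable_const _) (fun n => Eventually.of_forall fun a => ?_) ?_
  · refine (norm_integral_le_of_norm_le_const (C := 1)
      (Eventually.of_forall fun x => (hGn n (a, x)).le)).trans ?_
    simp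
  · filter_upwards [hX.condLaw, hX.ae_map_mem_Ioo] with a ha h01
    rw [ha]
    have := tendsto_integral_exp_inarLaw u t hlam h01 hr hrc
    rwa [Complex.ofReal_exp]

end IsRandomizedINAR

end Mixing

/-! ### Aggregation of independent copies -/

section Aggregation

variable {Ω : Type*} [MeasurableSpace Ω] {P : Measure Ω} [IsProbabilityMeasure P] {lam : ℝ}
  {α : ℕ → Ω → ℝ} {X : ℕ → ℕ → Ω → ℕ} {μ : Measure ℝ} {ι : Type*} [Fintype ι]

/-- Limit of the characteristic function of the aggregated partial sums of `N` copies. -/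
lemma tendsto_integral_exp_aggSum (hlam : 0 < lam) (hα : ∀ j, P.map (α j) = μ)
    (hX : ∀ j, IsRandomizedINAR lam (α j) (X j) P)
    (hindep : iIndepFun (fun j ω => (α j ω, fun k => X j k ω)) P)
    (hint : Integrable (fun a => lam / (1 - a)) μ)
    (N : ℕ) (u : ι → ℝ) (t : ι → ℝ≥0) {r : ℕ → ℝ} {c : ℝ} (hr : Tendsto r atTop (𝓝 0))
    (hrc : Tendsto (fun n : ℕ => n * r n ^ 2) atTop (𝓝 c)) :
    Tendsto (fun n : ℕ => ∫ ω, Complex.exp ((∑ i, u i * (r n * aggSum P α X N n (t i) ω) : ℝ) *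
        Complex.I) ∂P) atTop
      (𝓝 ((∫ a, (Real.exp (-(c * brownianForm u t * lam / 2 * varShape a)) : ℂ) ∂μ) ^ N)) := by
  have hce : ∀ᵐ ω ∂P, ∀ j k, (P[fun ω' => (X j k ω' : ℝ) |
      MeasurableSpace.comap (α j) inferInstance]) ω = lam / (1 - α j ω) := by
    refine ae_all_iff.2 fun j => ae_all_iff.2 fun k => ?_
    exact (hX j).condExp_eq hlam (by rwa [hα j]) k
  set G : ℕ → ℝ × (ℕ → ℕ) → ℂ := fun n p => Complex.exp ((r n * ∑ i, u i *
    ∑ k ∈ Finset.Icc 1 ⌊(n : ℝ) * t i⌋₊, ((p.2 k : ℝ) - lam / (1 - p.1)) : ℝ) * Complex.I) with hG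
  have hGm (n : ℕ) : Measurable (G n) := by
    simp only [hG]; fun_prop
  have hfac (n : ℕ) : ∫ ω, Complex.exp ((∑ i, u i * (r n * aggSum P α X N n (t i) ω) : ℝ) *
        Complex.I) ∂P = ∏ j : Fin N, ∫ ω, G n (α j ω, fun k => X j k ω) ∂P := by
    have h1 := (hindep.precomp (g := fun j : Fin N => (j : ℕ)) Fin.val_injective)
    rw [← h1.integral_fun_prod_comp (f := fun _ => G n)
      (fun j => ((hX j).measurable_param.prodMk (hX j).measurable_path).aemeasurable)
      (fun j => (hGm n).aestronglyMeasurable)]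
    refine integral_congr_ae ?_
    filter_upwards [hce] with ω hω
    simp only [aggSum, hω, hG]
    rw [← Complex.exp_sum, ← Finset.sum_mul, ← Complex.ofReal_sum]
    congr 3
    simp only [Finset.mul_sum, Finset.sum_range]
    rw [Finset.sum_comm]
    refine Finset.sum_congr rfl fun j _ => Finset.sum_congr rfl fun i _ =>
      Finset.sum_congr rfl fun k _ => by ring
  simp only [hfac]
  have h2 := tendsto_finsetProd (Finset.univ : Finset (Fin N)) fun j _ =>
    (hX j).tendsto_integral_exp hlam u t hr hrc
  simp only [hα, Finset.prod_const, Finset.card_univ, Fintype.card_fin] at h2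
  exact h2

end Aggregation

/-! ### Convergence in distribution from characteristic functions -/

lemma charFun_map_toLp {ι Ω : Type*} [Fintype ι] [MeasurableSpace Ω] {ρ : Measure Ω}
    {W : Ω → ι → ℝ} (hW : AEMeasurable W ρ) (u : EuclideanSpace ℝ ι) :
    charFun (ρ.map fun ω => (WithLp.toLp 2 (W ω) : EuclideanSpace ℝ ι)) u =
      ∫ ω, Complex.exp ((∑ i, u i * W ω i : ℝ) * Complex.I) ∂ρ := by
  have hm : AEMeasurable (fun ω => (WithLp.toLp 2 (W ω) : EuclideanSpace ℝ ι)) ρ := by fun_prop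
  rw [charFun_apply, integral_map hm (Continuous.aestronglyMeasurable (by fun_prop))]
  simp [PiLp.inner_apply]

/-- Lévy's continuity theorem for random vectors indexed by a finite type. -/
lemma tendstoInDistribution_pi_of_tendsto_integral_exp {ι : Type*} [Fintype ι] {Ω : ℕ → Type*}
    {Ω' : Type*} [∀ n, MeasurableSpace (Ω n)] [MeasurableSpace Ω'] {Y : (n : ℕ) → Ω n → ι → ℝ}
    {Z : Ω' → ι → ℝ} {μ : (n : ℕ) → Measure (Ω n)} [∀ n, IsProbabilityMeasure (μ n)]
    {μ' : Measure Ω'} [IsProbabilityMeasure μ'] (hY : ∀ n, AEMeasurable (Y n) (μ n))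
    (hZ : AEMeasurable Z μ')
    (h : ∀ u : ι → ℝ, Tendsto
      (fun n => ∫ ω, Complex.exp ((∑ i, u i * Y n ω i : ℝ) * Complex.I) ∂(μ n)) atTop
      (𝓝 (∫ ω, Complex.exp ((∑ i, u i * Z ω i : ℝ) * Complex.I) ∂μ'))) :
    TendstoInDistribution Y atTop Z μ μ' := by
  -- Characteristic functions are taken on an inner product space, so the vectors are moved to the
  -- Euclidean copy of `ι → ℝ` and brought back by a continuous map.
  have h1 : TendstoInDistribution
      (fun n ω => (WithLp.toLp 2 (Y n ω) : EuclideanSpace ℝ ι)) atTop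
      (fun ω => (WithLp.toLp 2 (Z ω) : EuclideanSpace ℝ ι)) μ μ' := by
    refine ⟨fun n => by have := hY n; fun_prop, by fun_prop, ?_⟩
    refine (ProbabilityMeasure.tendsto_iff_tendsto_charFun (E := EuclideanSpace ℝ ι)).2 fun u => ?_
    simp only [ProbabilityMeasure.coe_mk]
    rw [charFun_map_toLp hZ]
    simp only [charFun_map_toLp (hY _)]
    exact h u
  exact h1.continuous_comp (g := (WithLp.ofLp : EuclideanSpace ℝ ι → ι → ℝ))
    (PiLp.continuous_ofLp 2 _)

/-! ### Brownian motion with a random amplitude -/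

lemma brownianForm_nonneg {I : Finset ℝ≥0} (u : I → ℝ) :
    0 ≤ brownianForm u (fun i : I => i.1) := by
  have h := (BrownianReal.posSemidef_covMatrix I).dotProduct_mulVec_nonneg u
  simpa [brownianForm, dotProduct, Matrix.mulVec, Finset.mul_sum, mul_assoc, mul_comm,
    mul_left_comm] using h

section

variable {Ω' : Type*} [MeasurableSpace Ω'] {Q : Measure Ω'} {B : ℝ≥0 → Ω' → ℝ}

lemma integral_exp_isPreBrownianReal (hB : IsPreBrownianReal B Q) {I : Finset ℝ≥0} (u : I → ℝ)
    (s : ℝ) :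
    ∫ ω, Complex.exp ((∑ i : I, u i * (s * B i ω) : ℝ) * Complex.I) ∂Q =
      (Real.exp (-(s ^ 2 * brownianForm u (fun i : I => i.1) / 2)) : ℂ) := by
  have hlaw := hB.hasLaw I
  set F : (I → ℝ) → ℂ := fun x => Complex.exp ((∑ i : I, u i * (s * x i) : ℝ) * Complex.I) with hF
  have hFm : Measurable F := by simp only [hF]; fun_prop
  have h1 : ∫ ω, F (I.restrict (B · ω)) ∂Q = ∫ x, F x ∂(BrownianReal.projectiveFamily I) := by
    rw [← hlaw.map_eq, integral_map hlaw.aemeasurable hFm.aestronglyMeasurable]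
  refine h1.trans ?_
  rw [BrownianReal.integral_projectiveFamily]
  have h2 := charFun_multivariateGaussian (μ := 0) (BrownianReal.posSemidef_covMatrix I)
    (WithLp.toLp 2 (fun i : I => s * u i))
  rw [charFun_apply] at h2
  simp only [hF]
  have h3 (x : EuclideanSpace ℝ I) : ((∑ i : I, u i * (s * x i) : ℝ) : ℂ) * Complex.I =
      (inner ℝ x (WithLp.toLp 2 (fun i : I => s * u i)) : ℝ) * Complex.I := by
    congr 2
    simp only [PiLp.inner_apply, Real.inner_apply]
    exact Finset.sum_congr rfl fun i _ => by ring
  simp only [h3]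
  rw [h2, Complex.ofReal_exp]
  congr 1
  simp only [inner_zero_right, Complex.ofReal_zero, zero_mul, zero_sub]
  rw [Complex.ofReal_neg, ← Complex.ofReal_ofNat, ← Complex.ofReal_div]
  congr 3
  simp only [brownianForm, dotProduct, Matrix.mulVec, Finset.mul_sum, BrownianReal.covMatrix_apply]
  refine Finset.sum_congr rfl fun i _ => Finset.sum_congr rfl fun j _ => ?_
  push_cast
  ring

variable {Ω : Type*} [MeasurableSpace Ω]

/-- The intermediate limit process: a Brownian motion multiplied by an independent random
amplitude, the square root of the normalised sum of the variance shapes of `N` copies. -/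
noncomputable def mixedBrownian (lam : ℝ) (α : ℕ → Ω → ℝ) (B : ℝ≥0 → Ω' → ℝ) (N : ℕ)
    (p : Ω × Ω') (t : ℝ≥0) : ℝ :=
  Real.sqrt (lam / (N * Real.log N) * ∑ j ∈ Finset.range N, varShape (α j p.1)) * B t p.2

lemma measurable_mixedBrownian {lam : ℝ} {α : ℕ → Ω → ℝ} (hα : ∀ j, Measurable (α j))
    (hB : ∀ t, Measurable (B t)) (N : ℕ) : Measurable (mixedBrownian lam α B N) := by
  refine measurable_pi_lambda _ fun t => ?_
  have h1 : Measurable fun p : Ω × Ω' => ∑ j ∈ Finset.range N, varShape (α j p.1) :=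
    Finset.measurable_fun_sum _ fun j _ => measurable_varShape.comp ((hα j).comp measurable_fst)
  have h2 : Measurable fun p : Ω × Ω' => B t p.2 := (hB t).comp measurable_snd
  exact ((h1.const_mul _).sqrt).mul h2

variable {P : Measure Ω} [IsProbabilityMeasure P] [IsProbabilityMeasure Q] {μ : Measure ℝ}

/-- Integrating `B` first, with the amplitude frozen, the Gaussian characteristic function contains
only the squared amplitude, a sum over the copies; its exponential factors by independence of the `α
j`. The result is the limit found for the aggregated sums with `c = 1 / (N log N)`. -/
lemma integral_exp_mixedBrownian {lam : ℝ} (hlam : 0 < lam) {α : ℕ → Ω → ℝ}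
    (hα : ∀ j, Measurable (α j)) (hmap : ∀ j, P.map (α j) = μ)
    (hmem : ∀ᵐ a ∂μ, a ∈ Set.Ioo (0 : ℝ) 1) (hindep : iIndepFun α P)
    (hB : IsPreBrownianReal B Q) (hBm : ∀ t, Measurable (B t)) (N : ℕ) {I : Finset ℝ≥0}
    (u : I → ℝ) :
    ∫ p, Complex.exp ((∑ i : I, u i * mixedBrownian lam α B N p i : ℝ) * Complex.I)
        ∂(P.prod Q) =
      (∫ a, (Real.exp (-(1 / (N * Real.log N) * brownianForm u (fun i : I => i.1) * lam / 2 *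
        varShape a)) : ℂ) ∂μ) ^ N := by
  set q := brownianForm u (fun i : I => i.1) with hq
  have hM := measurable_mixedBrownian (lam := lam) hα hBm N
  have hint : Integrable (fun p => Complex.exp ((∑ i : I, u i * mixedBrownian lam α B N p i : ℝ) *
      Complex.I)) (P.prod Q) := by
    refine Integrable.of_bound (Measurable.aestronglyMeasurable ?_) 1
      (Eventually.of_forall fun p => (Complex.norm_exp_ofReal_mul_I _).le)
    have h (i : I) : Measurable fun p => mixedBrownian lam α B N p i :=
      (measurable_pi_apply (i : ℝ≥0)).comp hM
    fun_prop
  rw [integral_prod _ hint]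
  simp only [mixedBrownian, integral_exp_isPreBrownianReal hB]
  set g : ℝ → ℂ := fun a => (Real.exp (-(1 / (N * Real.log N) * q * lam / 2 * varShape a)) : ℂ)
    with hg
  have hgm : Measurable g := by
    have := measurable_varShape
    simp only [hg]; fun_prop
  have h1 := hindep.precomp (g := fun j : Fin N => (j : ℕ)) Fin.val_injective
  have h2 := h1.integral_fun_prod_comp (f := fun _ => g) (fun j => (hα j).aemeasurable)
    (fun j => hgm.aestronglyMeasurable)
  have h3 (j : ℕ) : ∫ ω, g (α j ω) ∂P = ∫ a, g a ∂μ := by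
    rw [← hmap j, integral_map (hα j).aemeasurable hgm.aestronglyMeasurable]
  simp only [h3, Finset.prod_const, Finset.card_univ, Fintype.card_fin] at h2
  rw [← h2]
  have hae : ∀ᵐ ω ∂P, ∀ j, α j ω ∈ Set.Ioo (0 : ℝ) 1 :=
    ae_all_iff.2 fun j => ae_of_ae_map (hα j).aemeasurable (by rwa [hmap j])
  refine integral_congr_ae ?_
  filter_upwards [hae] with ω hω
  have hNlog : 0 ≤ (N : ℝ) * Real.log N :=
    mul_nonneg (Nat.cast_nonneg _) (Real.log_natCast_nonneg _)
  simp only [hg]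
  rw [Real.sq_sqrt (mul_nonneg (div_nonneg hlam.le hNlog)
    (Finset.sum_nonneg fun j _ => varShape_nonneg (hω j))), ← Complex.ofReal_prod,
    ← Real.exp_sum]
  congr 2
  rw [Finset.sum_range, Finset.mul_sum, Finset.sum_mul, Finset.sum_div, ← Finset.sum_neg_distrib]
  exact Finset.sum_congr rfl fun j _ => by ring

end

lemma aemeasurable_aggSum {Ω : Type*} [MeasurableSpace Ω] {P : Measure Ω} [IsProbabilityMeasure P]
    {α : ℕ → Ω → ℝ} {X : ℕ → ℕ → Ω → ℕ} (hX : ∀ j k, Measurable (X j k)) (N n : ℕ) (t : ℝ≥0) :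
    AEMeasurable (aggSum P α X N n t) P := by
  unfold aggSum
  refine Finset.aemeasurable_fun_sum _ fun j _ => Finset.aemeasurable_fun_sum _ fun k _ => ?_
  refine AEMeasurable.sub ?_ integrable_condExp.aestronglyMeasurable.aemeasurable
  exact (Measurable.of_discrete (f := fun n : ℕ => (n : ℝ))).comp_aemeasurable (hX j k).aemeasurable

end RandomINAR

/-! ### The two successive limits -/

open RandomINAR in
/-- The intermediate limit, `n → ∞` with `N ≥ 2` fixed, is a process given by its law `ν N` on
path space (the coordinate process under `ν N`). -/
theorem theorem2p4
    {Ω : Type*} [MeasurableSpace Ω] (P : Measure Ω) [IsProbabilityMeasure P]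
    (lam : ℝ) (hlam : 0 < lam)
    (ψ : ℝ → ℝ) (ψ₁ : ℝ) (hψ₁ : 0 < ψ₁)
    (hψ_nonneg : ∀ x ∈ Set.Ioo (0 : ℝ) 1, 0 ≤ ψ x)
    (hψ_int : IntegrableOn ψ (Set.Ioo 0 1))
    (hψ_lim : Tendsto ψ (𝓝[<] 1) (𝓝 ψ₁))
    (α : ℕ → Ω → ℝ) (X : ℕ → ℕ → Ω → ℕ)
    (hα : ∀ j, P.map (α j) = (volume.restrict (Set.Ioo (0 : ℝ) 1)).withDensity
      fun x => ENNReal.ofReal (ψ x * (1 - x)))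
    (hX : ∀ j, RandomINAR.IsRandomizedINAR lam (α j) (X j) P)
    (hindep : iIndepFun (fun j ω => (α j ω, fun k => X j k ω)) P)
    {Ω' : Type*} [MeasurableSpace Ω'] (Q : Measure Ω') [IsProbabilityMeasure Q]
    (B : ℝ≥0 → Ω' → ℝ) (hB : IsBrownianReal B Q) :
    ∃ ν : ℕ → ProbabilityMeasure (ℝ≥0 → ℝ),
      (∀ N : ℕ, 2 ≤ N →
        RandomINAR.TendstoFDD
          (fun (n : ℕ) t ω =>
            (Real.sqrt ((n : ℝ) * N * Real.log N))⁻¹ * RandomINAR.aggSum P α X N n t ω)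
          atTop (fun t (y : ℝ≥0 → ℝ) => y t) (fun _ => P) (ν N : Measure (ℝ≥0 → ℝ))) ∧
      RandomINAR.TendstoFDD (fun (_ : ℕ) t (y : ℝ≥0 → ℝ) => y t) atTop
        (fun t ω => Real.sqrt (lam * ψ₁) * B t ω)
        (fun N => (ν N : Measure (ℝ≥0 → ℝ))) Q := by
  set μ := (volume.restrict (Set.Ioo (0 : ℝ) 1)).withDensity
      fun x => ENNReal.ofReal (ψ x * (1 - x)) with hμ
  have hαm (j : ℕ) := (hX j).measurable_param
  have hμprob : IsProbabilityMeasure μ := by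
    rw [← hα 0]; exact Measure.isProbabilityMeasure_map (hαm 0).aemeasurable
  have hmem : ∀ᵐ a ∂μ, a ∈ Set.Ioo (0 : ℝ) 1 := by
    rw [← hα 0]; exact (hX 0).ae_map_mem_Ioo
  have hindepα : iIndepFun α P := hindep.comp (fun _ p => p.1) fun _ => measurable_fst
  have hint := integrable_div_one_sub_withDensity lam hψ_nonneg hψ_int
  rw [← hμ] at hint
  -- a version of `B` that is measurable at every time
  have hBae := hB.toIsPreBrownianReal.aemeasurable
  have hB' : IsPreBrownianReal (fun t => (hBae t).mk (B t)) Q :=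
    hB.toIsPreBrownianReal.congr fun t => (hBae t).ae_eq_mk
  set B' : ℝ≥0 → Ω' → ℝ := fun t => (hBae t).mk (B t)
  have hBm (t : ℝ≥0) : Measurable (B' t) := (hBae t).measurable_mk
  have hM (N : ℕ) := measurable_mixedBrownian (lam := lam) hαm hBm N
  let ν : ℕ → ProbabilityMeasure (ℝ≥0 → ℝ) := fun N =>
    ⟨(P.prod Q).map (mixedBrownian lam α B' N), Measure.isProbabilityMeasure_map (hM N).aemeasurable⟩
  have hν (N : ℕ) (I : Finset ℝ≥0) (u : I → ℝ) :
      ∫ y, Complex.exp ((∑ i : I, u i * y i : ℝ) * Complex.I) ∂(ν N : Measure (ℝ≥0 → ℝ)) =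
      (∫ a, (Real.exp (-(1 / (N * Real.log N) * brownianForm u (fun i : I => i.1) * lam / 2 *
        varShape a)) : ℂ) ∂μ) ^ N := by
    rw [← integral_exp_mixedBrownian hlam hαm hα hmem hindepα hB' hBm N u]
    exact integral_map (hM N).aemeasurable (Measurable.aestronglyMeasurable (by fun_prop))
  refine ⟨ν, fun N hN I => ?_, fun I => ?_⟩
  -- As `N ≥ 2`, the normalisation `r n` tends to `0` and `n * r n ^ 2` equals `1 / (N log N)` for
  -- every `n > 0`.
  · have hlogN : 0 < Real.log N := Real.log_pos (by exact_mod_cast hN)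
    have hN0 : (0 : ℝ) < N := by positivity
    refine tendstoInDistribution_pi_of_tendsto_integral_exp (fun n => ?_)
      (Measurable.aemeasurable (by fun_prop)) fun u => ?_
    · exact aemeasurable_pi_lambda _ fun i =>
        (aemeasurable_aggSum (fun j => (hX j).measurable_process) N n i).const_mul _
    · rw [hν]
      refine tendsto_integral_exp_aggSum hlam hα hX hindep hint N u (fun i : I => i.1)
        (r := fun n => (Real.sqrt ((n : ℝ) * N * Real.log N))⁻¹) ?_ ?_
      · refine tendsto_inv_atTop_zero.comp (Real.tendsto_sqrt_atTop.comp ?_)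
        exact (tendsto_natCast_atTop_atTop.atTop_mul_const hN0).atTop_mul_const hlogN
      · refine tendsto_const_nhds.congr' ?_
        filter_upwards [eventually_gt_atTop 0] with n hn
        have hn0 : (0 : ℝ) < n := by exact_mod_cast hn
        rw [inv_pow, Real.sq_sqrt (by positivity)]
        field_simp
  · refine tendstoInDistribution_pi_of_tendsto_integral_exp
      (fun N => Measurable.aemeasurable (by fun_prop))
      (aemeasurable_pi_lambda _ fun i => (hBae i).const_mul _) fun u => ?_
    rw [integral_exp_isPreBrownianReal hB.toIsPreBrownianReal, Real.sq_sqrt (by positivity)]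
    simp only [hν]
    set q := brownianForm u (fun i : I => i.1) with hq
    have hq0 : 0 ≤ q := brownianForm_nonneg u
    -- The value `κ = q * lam / 2` makes `κ * ψ₁` the Gaussian exponent of `√(lam * ψ₁) * B` at `u`;
    -- nonnegativity of the Brownian form gives `0 ≤ κ`.
    have hlim := tendsto_integral_exp_neg_pow hψ_nonneg hψ_int hψ_lim hμ
      (κ := q * lam / 2) (by positivity)
    have hlim' := (Complex.continuous_ofReal.tendsto _).comp hlim
    have e : lam * ψ₁ * q / 2 = q * lam / 2 * ψ₁ := by ring
    rw [e]
    refine hlim'.congr fun N => ?_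
    simp only [Function.comp_apply, Complex.ofReal_pow]
    rw [← integral_complex_ofReal]
    congr 2
    funext a
    congr 3
    ring
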